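/- Let $m_0>0$, $\omega(k)=\sqrt{m_0^2+k^2}$ for $k\in\mathbb R$, and $u(k)=\sqrt2\,\omega(k)^{-1/2}$. Let $P=\sum_{j=0}^{2n}\beta_jX^j$ be a real polynomial of even degree $2n$ with $\beta_{2n}>0$, and let $g\in L^1(\mathbb R)\cap H^1(\mathbb R)$ be a real-valued, non-negative, even function, with $\hat g(k)=\int_{\mathbb R}g(x)e^{-ikx}\,dx$. Put $w_j(k_1,\dots,k_j)=\hat g(k_1+\dots+k_j)\prod_{m=1}^ju(k_m)$. For $z\in L^2(\mathbb R,dk;\mathbb C)$ consider the classical interaction $$b^\circ(z)=\sum_{j=0}^{2n}\sum_{\ell=0}^j2^{-j/2}\beta_j\binom j\ell b_{j,\ell}(z),\qquad b_{j,\ell}(z)=\int_{\mathbb R^j}\prod_{m=1}^{\ell}\overline{z(k_m)}\prod_{m=\ell+1}^{j}z(-k_m)\;w_j(k_1,\dots,k_j)\,dk_1\cdots dk_j ,$$ and its derivative $\partial_{\bar z}b^\circ(z)=\sum_{j,\ell}2^{-j/2}\beta_j\binom j\ell\,\partial_{\bar z}b_{j,\ell}(z)$, where $\partial_{\bar z}b_{j,0}(z)=0$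 and, for $\ell\ge1$, $$\partial_{\bar z}b_{j,\ell}(z)(k)=\ell\int_{\mathbb R^{j-1}}\prod_{m=1}^{\ell-1}\overline{z(k_m)}\prod_{m=\ell+1}^{j}z(-k_m)\;w_j(k_1,\dots,k_{\ell-1},k,k_{\ell+1},\dots,k_j)\prod_{m\ne\ell}dk_m .$$ For $s\ge0$ let $\mathcal H^{s}_\omega=\{z\in L^2(\mathbb R,dk;\mathbb C):\ \omega^{s}z\in L^2\}$, with the graph norm $\|z\|_{\mathcal H^{s}_\omega}^2=\|\omega^{s}z\|_2^2+\|z\|_2^2$. **Theorem.** For every $\varphi_0\in\mathcal H^{1/2}_\omega$, the Cauchy problem $$i\,\dot\varphi_t=\omega\varphi_t+\partial_{\bar z}b^\circ(\varphi_t),\qquad \varphi_t|_{t=0}=\varphi_0,$$ has a unique global mild solution $\varphi\in C^0(\mathbb R,\mathcal H^{1/2}_\omega)$; that is, there is exactly one $\varphi\in C^0(\mathbb R,\mathcal H^{1/2}_\omega)$ such that, for all $t\in\mathbb R$, $$\varphi_t=e^{-it\omega}\varphi_0-i\int_0^te^{-i(t-\tau)\omega}\,\partial_{\bar z}b^\circ(\varphi_\tau)\,d\tau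 ,$$ where $\partial_{\bar z}b^\circ(\varphi_\tau)\in L^2(\mathbb R,dk)$ for all $\tau$ and the integral is a Bochner integral in $L^2(\mathbb R,dk)$. -/

import Mathlib

open MeasureTheory
open scoped SchwartzMap ComplexConjugate

/-- The one-particle space `L²(ℝ, dk; ℂ)`. -/
abbrev OneParticle : Type := Lp ℂ 2 (volume : Measure ℝ)

/-- The dispersion relation `ω(k) = √(m₀² + k²)`. -/
noncomputable def dispersion (m₀ k : ℝ) : ℝ := Real.sqrt (m₀ ^ 2 + k ^ 2)

/-- The form factor `u(k) = √2 ω(k)^{-1/2}`. -/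
noncomputable def formFactor (m₀ k : ℝ) : ℝ := Real.sqrt 2 * dispersion m₀ k ^ (-(1 / 2) : ℝ)

/-- The (non-unitary) Fourier transform `ĝ(k) = ∫ g(x) e^{-ikx} dx`. -/
noncomputable def cutoffHat (g : ℝ → ℝ) (k : ℝ) : ℂ :=
  ∫ x : ℝ, (g x : ℂ) * Complex.exp (-(Complex.I * k * x))

/-- The real function `g` belongs to the Sobolev space `H¹(ℝ)`. -/
def MemH1 (g : ℝ → ℝ) : Prop :=
  ∃ f : Lp ℂ 2 (volume : Measure ℝ), (∀ᵐ x : ℝ, f x = (g x : ℂ)) ∧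
    TemperedDistribution.MemSobolev 1 2 (f : 𝓢'(ℝ, ℂ))

theorem continuous_dispersion (m₀ : ℝ) : Continuous (dispersion m₀) := by
  unfold dispersion
  fun_prop

/-! ### The spaces `D(ω^s)` with the graph norm -/

/-- The domain of the multiplication operator `ω^s` in `L²(ℝ, dk)`. -/
noncomputable def omegaDomain (m₀ s : ℝ) : Submodule ℂ OneParticle where
  carrier := {z | MemLp (fun k : ℝ => ((dispersion m₀ k ^ s : ℝ) : ℂ) * z k) 2}
  add_mem' {a b} ha hb := by
    refine (MemLp.add ha hb).ae_eq ?_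
    filter_upwards [Lp.coeFn_add a b] with k hk
    rw [hk, Pi.add_apply, Pi.add_apply, mul_add]
  zero_mem' := by
    refine (MemLp.zero (p := 2) (μ := (volume : Measure ℝ)) (ε := ℂ)).ae_eq ?_
    filter_upwards [Lp.coeFn_zero ℂ 2 (volume : Measure ℝ)] with k hk
    rw [hk]
    simp
  smul_mem' c z hz := by
    refine (MemLp.const_smul hz c).ae_eq ?_
    filter_upwards [Lp.coeFn_smul c z] with k hk
    simp only [hk, Pi.smul_apply, smul_eq_mul]
    ring

theorem memLp_of_mem_omegaDomain {m₀ s : ℝ} {z : OneParticle} (hz : z ∈ omegaDomain m₀ s) :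
    MemLp (fun k : ℝ => ((dispersion m₀ k ^ s : ℝ) : ℂ) * z k) 2 :=
  hz

/-- The operator `ω^s` on its domain. -/
noncomputable def omegaPow (m₀ s : ℝ) : omegaDomain m₀ s →ₗ[ℂ] OneParticle where
  toFun z := MemLp.toLp (fun k : ℝ => ((dispersion m₀ k ^ s : ℝ) : ℂ) * (z : OneParticle) k)
    (memLp_of_mem_omegaDomain z.2)
  map_add' a b := by
    rw [← MemLp.toLp_add, MemLp.toLp_eq_toLp_iff]
    filter_upwards [Lp.coeFn_add (a : OneParticle) (b : OneParticle)] with k hk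
    rw [Submodule.coe_add, hk, Pi.add_apply, mul_add, Pi.add_apply]
  map_smul' c z := by
    rw [RingHom.id_apply, ← MemLp.toLp_const_smul, MemLp.toLp_eq_toLp_iff]
    filter_upwards [Lp.coeFn_smul c (z : OneParticle)] with k hk
    simp only [Submodule.coe_smul, hk, Pi.smul_apply, smul_eq_mul]
    ring

/-- The space `H^s_ω = D(ω^s)`, as a type of its own: it carries the graph norm, not the norm
of `L²`. -/
def OmegaSpace (m₀ s : ℝ) : Type := omegaDomain m₀ s

namespace OmegaSpace

variable {m₀ s : ℝ}

noncomputable instance : AddCommGroup (OmegaSpace m₀ s) :=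
  inferInstanceAs (AddCommGroup (omegaDomain m₀ s))

noncomputable instance : Module ℂ (OmegaSpace m₀ s) :=
  inferInstanceAs (Module ℂ (omegaDomain m₀ s))

/-- The inclusion of `H^s_ω` in `L²`. -/
noncomputable def toL2 : OmegaSpace m₀ s →ₗ[ℂ] OneParticle := (omegaDomain m₀ s).subtype

/-- The operator `ω^s : H^s_ω → L²`. -/
noncomputable def weighted : OmegaSpace m₀ s →ₗ[ℂ] OneParticle := omegaPow m₀ s

/-- The graph map `z ↦ (ω^s z, z)`. -/
noncomputable def graphMap : OmegaSpace m₀ s →ₗ[ℂ] WithLp 2 (OneParticle × OneParticle) :=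
  (WithLp.linearEquiv 2 ℂ (OneParticle × OneParticle)).symm.toLinearMap ∘ₗ
    (weighted.prod toL2)

theorem graphMap_injective : Function.Injective (graphMap (m₀ := m₀) (s := s)) := by
  intro a b h
  exact Subtype.ext (congrArg (fun w : WithLp 2 (OneParticle × OneParticle) => w.snd) h)

/-- The graph norm. -/
noncomputable instance : NormedAddCommGroup (OmegaSpace m₀ s) :=
  NormedAddCommGroup.induced (OmegaSpace m₀ s) (WithLp 2 (OneParticle × OneParticle))
    graphMap graphMap_injective

noncomputable instance : NormedSpace ℂ (OmegaSpace m₀ s) :=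
  NormedSpace.induced ℂ (OmegaSpace m₀ s) (WithLp 2 (OneParticle × OneParticle)) graphMap

theorem norm_sq_eq (z : OmegaSpace m₀ s) : ‖z‖ ^ 2 = ‖weighted z‖ ^ 2 + ‖toL2 z‖ ^ 2 :=
  WithLp.prod_norm_sq_eq_of_L2 (graphMap z)

end OmegaSpace

/-! ### The free propagator -/

theorem memLp_freePhase_mul (m₀ t : ℝ) (z : OneParticle) :
    MemLp (fun k : ℝ => Complex.exp (-(Complex.I * t * dispersion m₀ k)) * z k) 2 := by
  have hc : Continuous fun k : ℝ => Complex.exp (-(Complex.I * t * dispersion m₀ k)) := by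
    have := continuous_dispersion m₀
    fun_prop
  refine (Lp.memLp z).of_le (hc.aestronglyMeasurable.mul (Lp.aestronglyMeasurable z)) ?_
  refine Filter.Eventually.of_forall fun k => ?_
  simp [Complex.norm_exp]

/-- The unitary group `e^{-itω}` on `L²(ℝ, dk)`. -/
noncomputable def freeEvolution (m₀ t : ℝ) (z : OneParticle) : OneParticle :=
  MemLp.toLp (fun k : ℝ => Complex.exp (-(Complex.I * t * dispersion m₀ k)) * z k)
    (memLp_freePhase_mul m₀ t z)

/-! ### Monomial symbols given by integral kernels and their `z̄`-derivative

A kernel `K(x, y)`, with `x ∈ ℝ^q` and `y ∈ ℝ^p`, is that of an operator `b̃` from the symmetric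
functions in `L²(ℝ^p)` to those in `L²(ℝ^q)`. It gives the monomial symbol
`b(z) = ⟨z^{⊗q}, b̃ z^{⊗p}⟩` of order `(p, q)`, whose derivative is
`∂_{z̄} b(z) = q (⟨z^{⊗(q-1)}| ⊗ 1) b̃ z^{⊗p}`. -/

/-- The monomial symbol `b(z) = ⟨z^{⊗q}, b̃ z^{⊗p}⟩`. -/
noncomputable def kernelSymbol {q p : ℕ} (K : (Fin q → ℝ) → (Fin p → ℝ) → ℂ) (z : ℝ → ℂ) : ℂ :=
  ∫ x : Fin q → ℝ, conj (∏ i, z (x i)) * ∫ y : Fin p → ℝ, K x y * ∏ i, z (y i)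

/-- The derivative `∂_{z̄} b(z) = q (⟨z^{⊗(q-1)}| ⊗ 1) b̃ z^{⊗p}`, as a function of `k`. -/
noncomputable def kernelDbar :
    {q p : ℕ} → ((Fin q → ℝ) → (Fin p → ℝ) → ℂ) → (ℝ → ℂ) → ℝ → ℂ
  | 0, _, _, _, _ => 0
  | q + 1, p, K, z, k =>
      ((q + 1 : ℕ) : ℂ) * ∫ x : Fin q → ℝ, conj (∏ i, z (x i)) *
        ∫ y : Fin p → ℝ, K (Fin.snoc (α := fun _ => ℝ) x k) y * ∏ i, z (y i)

/-! ### The `P(φ)₂` interaction -/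

/-- `w_j(k₁, …, k_j) = ĝ(k₁ + ⋯ + k_j) ∏ u(k_m)`. -/
noncomputable def interactionKernel (m₀ : ℝ) (g : ℝ → ℝ) {j : ℕ} (k : Fin j → ℝ) : ℂ :=
  cutoffHat g (∑ m, k m) * ∏ m, (formFactor m₀ (k m) : ℂ)

/-- The kernel of the operator `b̃_{j,ℓ}`, with `q = ℓ` and `p = j - ℓ`, for which
`⟨z^{⊗q}, b̃_{j,ℓ} z^{⊗p}⟩ = ⟨z^{⊗ℓ} ⊗ (𝔠z)^{⊗(j-ℓ)}, w_j⟩`. Since the conjugation is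
`𝔠z(k) = conj (z(-k))`, it is `(x, y) ↦ w_j(x, -y)`. -/
noncomputable def monomialKernel (m₀ : ℝ) (g : ℝ → ℝ) (q p : ℕ)
    (x : Fin q → ℝ) (y : Fin p → ℝ) : ℂ :=
  interactionKernel m₀ g (Fin.append x (-y))

/-- The coefficient `2^{-j/2} β_j (j choose ℓ)`. -/
noncomputable def interactionCoeff (P : Polynomial ℝ) (j l : ℕ) : ℝ :=
  (2 : ℝ) ^ (-(j : ℝ) / 2) * P.coeff j * (j.choose l : ℝ)

/-- The classical interaction
`b°(z) = ∑_{j ≤ deg P} ∑_{ℓ ≤ j} 2^{-j/2} β_j (j choose ℓ) b_{j,ℓ}(z)`. -/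
noncomputable def interactionSymbol (m₀ : ℝ) (P : Polynomial ℝ) (g : ℝ → ℝ) (z : ℝ → ℂ) : ℂ :=
  ∑ j ∈ Finset.range (P.natDegree + 1), ∑ l ∈ Finset.range (j + 1),
    (interactionCoeff P j l : ℂ) * kernelSymbol (monomialKernel m₀ g l (j - l)) z

/-- The derivative `∂_{z̄} b°(z)`, as a function of `k`. -/
noncomputable def interactionDbar (m₀ : ℝ) (P : Polynomial ℝ) (g : ℝ → ℝ) (z : ℝ → ℂ)
    (k : ℝ) : ℂ :=
  ∑ j ∈ Finset.range (P.natDegree + 1), ∑ l ∈ Finset.range (j + 1),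
    (interactionCoeff P j l : ℂ) * kernelDbar (monomialKernel m₀ g l (j - l)) z k

/-- `φ` is a mild solution, for all times, of `i φ' = ω φ + ∂_{z̄} b°(φ)` with initial value `φ₀`:
the functions `∂_{z̄} b°(φ_τ)` are classes `F τ` in `L²`, the integrand of the Duhamel term is
Bochner integrable, and `φ_t = e^{-itω} φ₀ - i ∫₀ᵗ e^{-i(t-τ)ω} ∂_{z̄} b°(φ_τ) dτ` for every `t`. -/
def IsMildSolution (m₀ : ℝ) (P : Polynomial ℝ) (g : ℝ → ℝ) (φ₀ : OneParticle)
    (φ : ℝ → OneParticle) : Prop :=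
  ∃ F : ℝ → OneParticle,
    (∀ τ : ℝ, ∀ᵐ k : ℝ, F τ k = interactionDbar m₀ P g (φ τ) k) ∧
    ∀ t : ℝ,
      IntervalIntegrable (fun τ : ℝ => freeEvolution m₀ (t - τ) (F τ)) volume 0 t ∧
      φ t = freeEvolution m₀ t φ₀ -
        Complex.I • ∫ τ in (0 : ℝ)..t, freeEvolution m₀ (t - τ) (F τ)

/-! ### The Fourier transform on `L¹ ∩ L²` -/

/-! The coordinate y = ω^{1/2} z identifies the energy space with L² (`OmegaSpace.weighted`,
`ofWeighted`). In one dimension ω⁻¹ ∈ L², so by Cauchy–Schwarz the field Φ_y(x) = 2 Re ∫ ω⁻¹ y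
e^{ikx} dk is a bounded continuous function, depending linearly and continuously on y (`fieldMap`).
The binomial sum over ℓ collapses to ∂_{z̄} b°(ω^{-1/2} y) = ω^{-1/2} (g P'(Φ_y))^
(`interactionDbar_eq`), and by Plancherel with g ∈ L² the map f ↦ (g f)^ is bounded from bounded
continuous functions to L² (`sourceMap`). The equation becomes i ẏ = ω y + (g P'(Φ_y))^, with a
locally Lipschitz force on L².

Existence: freezing P' outside [-R, R] makes the force bounded and globally Lipschitz. In the
interaction picture w = e^{itω} y the unbounded ω disappears, and Picard–Lindelöf gives a global
flow (`exists_interaction_flow`). With V_R(s) = P(0) + ∫₀ˢ `clampedDeriv P R`, the energy ‖y‖² + ∫ g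
V_R(Φ_y) is conserved (`energy_conservation`): y need not be differentiable, but ω⁻¹ y is, and
increments of the potential are pairings with increments of ω⁻¹ y. Even degree and positive leading
coefficient bound V_R below uniformly for large R (`exists_lower_bound_primitive`). Since g ≥ 0, the
energy bounds ‖y_t‖, hence the field, independently of R. For R beyond that bound the truncation
never acts.

Uniqueness: on a compact time interval the fields of two continuous solutions are bounded by a
common R, so both solve the same Lipschitz equation in the interaction picture
(`IsMildSolution.eq_of_continuous`). -/

open FourierTransform in
/-- On integrable classes the `L²` Fourier transform is given by the Fourier integral. -/
theorem coeFn_fourier_ae_eq_of_integrable (f : OneParticle) (hf : Integrable f) :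
    (𝓕 f : OneParticle) =ᵐ[volume] 𝓕 (f : ℝ → ℂ) := by
  have hcont : Continuous (𝓕 (f : ℝ → ℂ)) :=
    VectorFourier.fourierIntegral_continuous Real.continuous_fourierChar
      (by exact continuous_inner) hf
  have hloc : LocallyIntegrable ((𝓕 f : OneParticle) : ℝ → ℂ) volume :=
    (Lp.memLp (𝓕 f : OneParticle)).locallyIntegrable (by norm_num)
  have hdiff : LocallyIntegrable (fun k => (𝓕 f : OneParticle) k - 𝓕 (f : ℝ → ℂ) k) volume :=
    hloc.sub hcont.locallyIntegrable
  have key : ∀ᵐ k : ℝ, (𝓕 f : OneParticle) k - 𝓕 (f : ℝ → ℂ) k = 0 := by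
    -- Test against smooth compactly supported φ. The distributional definition puts the Fourier
    -- transform on φ, and the multiplication formula moves it back onto the integrable f.
    refine ae_eq_zero_of_integral_contDiff_smul_eq_zero hdiff fun φ hφ hφc => ?_
    have hφc' : HasCompactSupport fun x => (φ x : ℂ) := hφc.comp_left Complex.ofReal_zero
    have hφ' : ContDiff ℝ (⊤ : ℕ∞) fun x => (φ x : ℂ) := Complex.ofRealCLM.contDiff.comp hφ
    set ψ : 𝓢(ℝ, ℂ) := hφc'.toSchwartzMap hφ' with hψ
    have hψφ : ∀ x, ψ x = (φ x : ℂ) := fun x => rfl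
    have h1 := congrArg (fun T : 𝓢'(ℝ, ℂ) => T ψ) (Lp.fourier_toTemperedDistribution_eq f)
    simp only [TemperedDistribution.fourier_apply, Lp.toTemperedDistribution_apply] at h1
    have h2 : ∫ x, (𝓕 ψ) x • f x = ∫ k, ψ k • 𝓕 (f : ℝ → ℂ) k := by
      rw [SchwartzMap.fourier_coe]
      have h := VectorFourier.integral_fourierIntegral_smul_eq_flip (L := innerₗ ℝ)
        Real.continuous_fourierChar (by exact continuous_inner) (ψ.integrable (μ := volume)) hf
      rwa [flip_innerₗ] at h
    have i1 : Integrable fun k => φ k • (𝓕 f : OneParticle) k :=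
      hloc.integrable_smul_left_of_hasCompactSupport hφ.continuous hφc
    have i2 : Integrable fun k => φ k • 𝓕 (f : ℝ → ℂ) k :=
      hcont.locallyIntegrable.integrable_smul_left_of_hasCompactSupport hφ.continuous hφc
    simp only [smul_sub]
    rw [integral_sub i1 i2, sub_eq_zero]
    simpa only [hψφ, smul_eq_mul, Complex.real_smul] using h1.symm.trans h2
  filter_upwards [key] with k hk using sub_eq_zero.mp hk

/-- The Fourier transform `k ↦ ∫ h(x) e^{-ikx} dx` with the angular normalization. -/
noncomputable def angularFourier (h : ℝ → ℂ) (k : ℝ) : ℂ :=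
  ∫ x : ℝ, h x * Complex.exp (-(Complex.I * k * x))

open FourierTransform in
theorem angularFourier_eq_fourier (h : ℝ → ℂ) (k : ℝ) :
    angularFourier h k = 𝓕 h ((2 * Real.pi)⁻¹ * k) := by
  rw [Real.fourier_real_eq_integral_exp_smul, angularFourier]
  refine integral_congr_ae (Filter.Eventually.of_forall fun x => ?_)
  simp only [smul_eq_mul]
  rw [mul_comm]
  congr 2
  have : (Real.pi : ℂ) ≠ 0 := by exact_mod_cast Real.pi_ne_zero
  push_cast
  field_simp

theorem angularFourier_congr {h₁ h₂ : ℝ → ℂ} (h : h₁ =ᵐ[volume] h₂) :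
    angularFourier h₁ = angularFourier h₂ := by
  funext k
  refine integral_congr_ae ?_
  filter_upwards [h] with x hx
  rw [hx]

/-- The constant `√(2π)` in Plancherel's formula, as an extended nonnegative real. -/
noncomputable def plancherelConst : ENNReal :=
  ENNReal.ofReal |((2 * Real.pi)⁻¹)⁻¹| ^ (1 / (2 : ENNReal)).toReal

theorem plancherelConst_ne_top : plancherelConst ≠ ⊤ :=
  ENNReal.rpow_ne_top_of_nonneg (by positivity) ENNReal.ofReal_ne_top

open FourierTransform in
/-- Plancherel's formula, with the measurability needed to make it an `L²` statement. -/
theorem plancherel_angularFourier {h : ℝ → ℂ} (h1 : Integrable h) (h2 : MemLp h 2) :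
    MemLp (angularFourier h) 2 ∧
      eLpNorm (angularFourier h) 2 = plancherelConst * eLpNorm h 2 := by
  have hfi : Integrable (h2.toLp h) := h1.congr h2.coeFn_toLp.symm
  have hpi : ((2 * Real.pi)⁻¹ : ℝ) ≠ 0 := by positivity
  have hcomp : angularFourier h = (𝓕 (h2.toLp h : ℝ → ℂ)) ∘ fun k => (2 * Real.pi)⁻¹ * k := by
    rw [← angularFourier_congr h2.coeFn_toLp]
    funext k
    exact angularFourier_eq_fourier _ k
  have hae := coeFn_fourier_ae_eq_of_integrable _ hfi
  have hm : AEStronglyMeasurable (𝓕 (h2.toLp h : ℝ → ℂ)) volume :=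
    (Lp.aestronglyMeasurable _).congr hae
  -- Rescaling the frequency by (2π)⁻¹ multiplies the measure by 2π, hence the L² norm by its square
  -- root; the rest is the unitarity of the L² Fourier transform.
  have hmap := Real.map_volume_mul_left hpi
  have hnorm : eLpNorm (angularFourier h) 2 = plancherelConst * eLpNorm h 2 := by
    rw [hcomp, ← eLpNorm_map_measure (by rw [hmap]; exact hm.smul_measure _) (by fun_prop), hmap,
      eLpNorm_smul_measure_of_ne_top (by norm_num), smul_eq_mul, ← eLpNorm_congr_ae hae,
      plancherelConst]
    congr 1
    rw [← eLpNorm_congr_ae h2.coeFn_toLp, ← Lp.enorm_def, ← Lp.enorm_def, ← ofReal_norm,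
      Lp.norm_fourier_eq, ofReal_norm]
  refine ⟨⟨?_, ?_⟩, hnorm⟩
  · rw [hcomp]
    exact AEStronglyMeasurable.comp_aemeasurable (by rw [hmap]; exact hm.smul_measure _)
      (by fun_prop)
  · rw [hnorm]
    exact ENNReal.mul_lt_top plancherelConst_ne_top.lt_top h2.eLpNorm_lt_top

/-! ### Sources: Fourier transforms of g times a bounded continuous function -/

section Source

open scoped BoundedContinuousFunction

variable {g : ℝ → ℝ}

theorem integrable_cutoff_mul (hg1 : Integrable g) (f : ℝ →ᵇ ℝ) :
    Integrable fun x => ((g x * f x : ℝ) : ℂ) :=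
  (hg1.mul_bdd f.continuous.aestronglyMeasurable
    (Filter.Eventually.of_forall fun x => f.norm_coe_le_norm x)).ofReal

theorem eLpNorm_cutoff_mul_le (f : ℝ →ᵇ ℝ) :
    eLpNorm (fun x => ((g x * f x : ℝ) : ℂ)) 2 ≤ ENNReal.ofReal ‖f‖ * eLpNorm g 2 := by
  refine eLpNorm_le_mul_eLpNorm_of_ae_le_mul (Filter.Eventually.of_forall fun x => ?_) 2
  rw [Complex.norm_real, norm_mul, mul_comm]
  exact mul_le_mul_of_nonneg_right (f.norm_coe_le_norm x) (norm_nonneg _)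

theorem memLp_cutoff_mul (hg1 : Integrable g) (hg2 : MemLp g 2) (f : ℝ →ᵇ ℝ) :
    MemLp (fun x => ((g x * f x : ℝ) : ℂ)) 2 :=
  ⟨(integrable_cutoff_mul hg1 f).aestronglyMeasurable, (eLpNorm_cutoff_mul_le f).trans_lt
    (ENNReal.mul_lt_top ENNReal.ofReal_lt_top hg2.eLpNorm_lt_top)⟩

/-- The Fourier transform of `g f`, for a bounded continuous function `f`, as an element
of `L²`. -/
noncomputable def sourceMap (hg1 : Integrable g) (hg2 : MemLp g 2) :
    (ℝ →ᵇ ℝ) →L[ℝ] OneParticle :=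
  LinearMap.mkContinuous
    { toFun := fun f => (plancherel_angularFourier (integrable_cutoff_mul hg1 f)
        (memLp_cutoff_mul hg1 hg2 f)).1.toLp _
      map_add' := fun f₁ f₂ => by
        rw [← MemLp.toLp_add, MemLp.toLp_eq_toLp_iff]
        refine Filter.Eventually.of_forall fun k => ?_
        have hi : ∀ f : ℝ →ᵇ ℝ, Integrable
            fun x => ((g x * f x : ℝ) : ℂ) * Complex.exp (-(Complex.I * k * x)) := fun f =>
          (integrable_cutoff_mul hg1 f).mul_bdd (c := 1)
            (Continuous.aestronglyMeasurable (by fun_prop))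
            (Filter.Eventually.of_forall fun x => by simp [Complex.norm_exp])
        simp only [Pi.add_apply, angularFourier]
        rw [← integral_add (hi f₁) (hi f₂)]
        refine integral_congr_ae (Filter.Eventually.of_forall fun x => ?_)
        simp only [BoundedContinuousFunction.add_apply]
        push_cast
        ring
      map_smul' := fun c f => by
        rw [RingHom.id_apply, ← MemLp.toLp_const_smul, MemLp.toLp_eq_toLp_iff]
        refine Filter.Eventually.of_forall fun k => ?_
        simp only [Pi.smul_apply, angularFourier]
        rw [← integral_smul]
        refine integral_congr_ae (Filter.Eventually.of_forall fun x => ?_)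
        simp only [BoundedContinuousFunction.smul_apply, smul_eq_mul, Complex.real_smul]
        push_cast
        ring }
    (plancherelConst * eLpNorm g 2).toReal (fun f => by
      change ‖MemLp.toLp _ (plancherel_angularFourier (integrable_cutoff_mul hg1 f)
        (memLp_cutoff_mul hg1 hg2 f)).1‖ ≤ _
      rw [Lp.norm_toLp, (plancherel_angularFourier (integrable_cutoff_mul hg1 f)
        (memLp_cutoff_mul hg1 hg2 f)).2, ← ENNReal.toReal_ofReal (norm_nonneg f),
        ← ENNReal.toReal_mul]
      refine ENNReal.toReal_mono (ENNReal.mul_ne_top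
        (ENNReal.mul_ne_top plancherelConst_ne_top hg2.eLpNorm_ne_top) ENNReal.ofReal_ne_top) ?_
      rw [mul_assoc, mul_comm (eLpNorm g 2 volume)]
      gcongr
      exact eLpNorm_cutoff_mul_le f)

theorem coeFn_sourceMap (hg1 : Integrable g) (hg2 : MemLp g 2) (f : ℝ →ᵇ ℝ) :
    sourceMap hg1 hg2 f =ᵐ[volume] angularFourier fun x => ((g x * f x : ℝ) : ℂ) :=
  (plancherel_angularFourier (integrable_cutoff_mul hg1 f)
    (memLp_cutoff_mul hg1 hg2 f)).1.coeFn_toLp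

end Source

/-! ### Multiplication operators on `L²` -/

section Multiplication

open scoped BoundedContinuousFunction
open Filter Topology

theorem memLp_bcf_mul (m : ℝ →ᵇ ℂ) (z : OneParticle) : MemLp (fun k => m k * z k) 2 :=
  (Lp.memLp z).of_le_mul (c := ‖m‖)
    (m.continuous.aestronglyMeasurable.mul (Lp.aestronglyMeasurable z))
    (Eventually.of_forall fun k => by
      rw [norm_mul]
      exact mul_le_mul_of_nonneg_right (m.norm_coe_le_norm k) (norm_nonneg _))

/-- Multiplication by a bounded continuous function. -/
noncomputable def mulOp (m : ℝ →ᵇ ℂ) : OneParticle →L[ℂ] OneParticle :=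
  LinearMap.mkContinuous
    { toFun := fun z => (memLp_bcf_mul m z).toLp _
      map_add' := fun a b => by
        rw [← MemLp.toLp_add, MemLp.toLp_eq_toLp_iff]
        filter_upwards [Lp.coeFn_add a b] with k hk
        simp only [hk, Pi.add_apply, mul_add]
      map_smul' := fun c a => by
        rw [RingHom.id_apply, ← MemLp.toLp_const_smul, MemLp.toLp_eq_toLp_iff]
        filter_upwards [Lp.coeFn_smul c a] with k hk
        simp only [hk, Pi.smul_apply, smul_eq_mul]
        ring }
    ‖m‖ (fun z => by
      refine Lp.norm_le_mul_norm_of_ae_le_mul ?_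
      filter_upwards [(memLp_bcf_mul m z).coeFn_toLp] with k hk
      change ‖MemLp.toLp _ (memLp_bcf_mul m z) k‖ ≤ _
      rw [hk, norm_mul]
      exact mul_le_mul_of_nonneg_right (m.norm_coe_le_norm k) (norm_nonneg _))

theorem coeFn_mulOp (m : ℝ →ᵇ ℂ) (z : OneParticle) :
    mulOp m z =ᵐ[volume] fun k => m k * z k :=
  (memLp_bcf_mul m z).coeFn_toLp

theorem mulOp_mul (m n : ℝ →ᵇ ℂ) (z : OneParticle) : mulOp (m * n) z = mulOp m (mulOp n z) := by
  refine Lp.ext ?_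
  filter_upwards [coeFn_mulOp (m * n) z, coeFn_mulOp m (mulOp n z), coeFn_mulOp n z]
    with k h1 h2 h3
  rw [h1, h2, h3, BoundedContinuousFunction.mul_apply, mul_assoc]

theorem mulOp_one (z : OneParticle) : mulOp 1 z = z := by
  refine Lp.ext ?_
  filter_upwards [coeFn_mulOp 1 z] with k h1
  rw [h1]
  exact one_mul _

theorem mulOp_comm (m n : ℝ →ᵇ ℂ) (z : OneParticle) :
    mulOp m (mulOp n z) = mulOp n (mulOp m z) := by
  rw [← mulOp_mul, mul_comm, mulOp_mul]

theorem norm_mulOp_of_norm_one {m : ℝ →ᵇ ℂ} (hm : ∀ k, ‖m k‖ = 1) (z : OneParticle) :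
    ‖mulOp m z‖ = ‖z‖ := by
  rw [Lp.norm_def, Lp.norm_def]
  congr 1
  refine eLpNorm_congr_norm_ae ?_
  filter_upwards [coeFn_mulOp m z] with k hk
  rw [hk, norm_mul, hm, one_mul]

theorem inner_mulOp (m : ℝ →ᵇ ℂ) (a b : OneParticle) :
    inner ℂ (mulOp m a) b = inner ℂ a (mulOp (star m) b) := by
  rw [L2.inner_def, L2.inner_def]
  refine integral_congr_ae ?_
  filter_upwards [coeFn_mulOp m a, coeFn_mulOp (star m) b] with k h1 h2
  rw [h1, h2]
  simp only [RCLike.inner_apply, map_mul, BoundedContinuousFunction.star_apply]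
  rw [RCLike.star_def]
  ring

theorem norm_sq_eq_integral (z : OneParticle) : ‖z‖ ^ 2 = ∫ k, ‖z k‖ ^ 2 := by
  have h := L2.inner_def (𝕜 := ℂ) z z
  rw [inner_self_eq_norm_sq_to_K] at h
  have h2 : ∀ k, inner ℂ (z k) (z k) = ((‖z k‖ ^ 2 : ℝ) : ℂ) := fun k => by
    rw [inner_self_eq_norm_sq_to_K]; simp
  simp only [h2, integral_complex_ofReal] at h
  refine Complex.ofReal_injective (Eq.trans ?_ h)
  simp

/-- Dominated convergence for multiplication operators. -/
theorem tendsto_mulOp {ι : Type*} {l : Filter ι} [l.IsCountablyGenerated] {m : ι → ℝ →ᵇ ℂ}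
    {n : ℝ →ᵇ ℂ} {C : ℝ} (hC : ∀ᶠ i in l, ∀ k, ‖m i k‖ ≤ C)
    (hlim : ∀ k, Tendsto (fun i => m i k) l (𝓝 (n k))) (z : OneParticle) :
    Tendsto (fun i => mulOp (m i) z) l (𝓝 (mulOp n z)) := by
  rw [tendsto_iff_norm_sub_tendsto_zero]
  have key : Tendsto (fun i => ∫ k, ‖(m i k - n k) * z k‖ ^ 2) l (𝓝 (∫ _ : ℝ, (0 : ℝ))) := by
    refine tendsto_integral_filter_of_dominated_convergence
      (fun k => (C + ‖n‖) ^ 2 * ‖z k‖ ^ 2) ?_ ?_ ?_ ?_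
    · refine Eventually.of_forall fun i => ?_
      exact (((m i - n).continuous.aestronglyMeasurable.mul
        (Lp.aestronglyMeasurable z)).norm).pow 2
    · filter_upwards [hC] with i hi
      refine Eventually.of_forall fun k => ?_
      rw [Real.norm_of_nonneg (by positivity), norm_mul, mul_pow]
      gcongr
      exact (norm_sub_le _ _).trans (add_le_add (hi k) (n.norm_coe_le_norm k))
    · exact ((memLp_two_iff_integrable_sq_norm (Lp.aestronglyMeasurable z)).mp
        (Lp.memLp z)).const_mul _
    · refine Eventually.of_forall fun k => ?_
      have h : Tendsto (fun i => ‖(m i k - n k) * z k‖ ^ 2) l (𝓝 (‖(n k - n k) * z k‖ ^ 2)) :=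
        ((((hlim k).sub_const _).mul_const _).norm).pow 2
      simpa using h
  rw [integral_zero] at key
  have h2 := key.sqrt
  rw [Real.sqrt_zero] at h2
  refine h2.congr fun i => ?_
  rw [← Real.sqrt_sq (norm_nonneg (mulOp (m i) z - mulOp n z)), norm_sq_eq_integral]
  congr 1
  refine integral_congr_ae ?_
  filter_upwards [coeFn_mulOp (m i) z, coeFn_mulOp n z, Lp.coeFn_sub (mulOp (m i) z) (mulOp n z)]
    with k h1 h2 h3
  rw [h3, Pi.sub_apply, h1, h2, sub_mul]

end Multiplication

/-! ### Functions of the dispersion relation -/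

section Dispersion

open scoped BoundedContinuousFunction
open Filter Topology

variable {m₀ : ℝ}

theorem le_dispersion (m₀ k : ℝ) : m₀ ≤ dispersion m₀ k :=
  Real.le_sqrt_of_sq_le (by nlinarith [sq_nonneg k])

theorem dispersion_pos (hm : 0 < m₀) (k : ℝ) : 0 < dispersion m₀ k :=
  hm.trans_le (le_dispersion m₀ k)

theorem dispersion_neg (k : ℝ) : dispersion m₀ (-k) = dispersion m₀ k := by
  rw [dispersion, dispersion, neg_sq]

theorem dispersion_sq (k : ℝ) : dispersion m₀ k ^ 2 = m₀ ^ 2 + k ^ 2 :=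
  Real.sq_sqrt (by positivity)

/-- The bounded function `ω^{-s}`. -/
noncomputable def omegaNegPow (hm : 0 < m₀) {s : ℝ} (hs : 0 ≤ s) : ℝ →ᵇ ℂ :=
  BoundedContinuousFunction.ofNormedAddCommGroup
    (fun k => ((dispersion m₀ k ^ (-s) : ℝ) : ℂ))
    (Complex.continuous_ofReal.comp ((continuous_dispersion m₀).rpow_const
      fun k => Or.inl (dispersion_pos hm k).ne'))
    (m₀ ^ (-s)) (fun k => by
      rw [Complex.norm_real, Real.norm_of_nonneg (Real.rpow_nonneg (dispersion_pos hm k).le _)]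
      exact Real.rpow_le_rpow_of_nonpos hm (le_dispersion m₀ k) (by linarith))

@[simp]
theorem omegaNegPow_apply (hm : 0 < m₀) {s : ℝ} (hs : 0 ≤ s) (k : ℝ) :
    omegaNegPow hm hs k = ((dispersion m₀ k ^ (-s) : ℝ) : ℂ) := rfl

/-- The phase `e^{-itω}`. -/
noncomputable def phase (m₀ t : ℝ) : ℝ →ᵇ ℂ :=
  BoundedContinuousFunction.ofNormedAddCommGroup
    (fun k => Complex.exp (-(Complex.I * t * dispersion m₀ k)))
    (by have := continuous_dispersion m₀; fun_prop) 1 (fun k => by simp [Complex.norm_exp])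

theorem phase_apply (m₀ t k : ℝ) :
    phase m₀ t k = Complex.exp (-(Complex.I * t * dispersion m₀ k)) := rfl

theorem norm_phase_apply (m₀ t k : ℝ) : ‖phase m₀ t k‖ = 1 := by
  simp [phase_apply, Complex.norm_exp]

theorem freeEvolution_eq_mulOp (m₀ t : ℝ) (z : OneParticle) :
    freeEvolution m₀ t z = mulOp (phase m₀ t) z := rfl

theorem phase_add (m₀ s t : ℝ) : phase m₀ (s + t) = phase m₀ s * phase m₀ t := by
  ext k
  rw [BoundedContinuousFunction.mul_apply, phase_apply, phase_apply, phase_apply, ← Complex.exp_add]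
  push_cast
  ring_nf

theorem phase_zero (m₀ : ℝ) : phase m₀ 0 = 1 := by
  ext k
  simp [phase_apply]

theorem freeEvolution_add (s t : ℝ) (z : OneParticle) :
    freeEvolution m₀ (s + t) z = freeEvolution m₀ s (freeEvolution m₀ t z) := by
  simp only [freeEvolution_eq_mulOp, phase_add, mulOp_mul]

theorem freeEvolution_zero (z : OneParticle) : freeEvolution m₀ 0 z = z := by
  rw [freeEvolution_eq_mulOp, phase_zero, mulOp_one]

theorem freeEvolution_neg_self (t : ℝ) (z : OneParticle) :
    freeEvolution m₀ (-t) (freeEvolution m₀ t z) = z := by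
  rw [← freeEvolution_add, neg_add_cancel, freeEvolution_zero]

theorem freeEvolution_self_neg (t : ℝ) (z : OneParticle) :
    freeEvolution m₀ t (freeEvolution m₀ (-t) z) = z := by
  rw [← freeEvolution_add, add_neg_cancel, freeEvolution_zero]

theorem norm_freeEvolution (t : ℝ) (z : OneParticle) : ‖freeEvolution m₀ t z‖ = ‖z‖ :=
  norm_mulOp_of_norm_one (norm_phase_apply m₀ t) z

theorem freeEvolution_sub (t : ℝ) (a b : OneParticle) :
    freeEvolution m₀ t (a - b) = freeEvolution m₀ t a - freeEvolution m₀ t b :=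
  map_sub (mulOp (phase m₀ t)) a b

theorem inner_freeEvolution (t : ℝ) (a b : OneParticle) :
    inner ℂ (freeEvolution m₀ t a) b = inner ℂ a (freeEvolution m₀ (-t) b) := by
  have h : star (phase m₀ t) = phase m₀ (-t) := by
    ext k
    rw [BoundedContinuousFunction.star_apply, phase_apply, phase_apply, RCLike.star_def,
      ← Complex.exp_conj]
    simp
  rw [freeEvolution_eq_mulOp, inner_mulOp, freeEvolution_eq_mulOp, h]

theorem tendsto_freeEvolution (t : ℝ) (z : OneParticle) :
    Tendsto (fun s => freeEvolution m₀ s z) (𝓝 t) (𝓝 (freeEvolution m₀ t z)) := by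
  simp only [freeEvolution_eq_mulOp]
  refine tendsto_mulOp (C := 1) (Eventually.of_forall fun s k => (norm_phase_apply m₀ s k).le)
    (fun k => ?_) z
  simp only [phase_apply]
  exact Continuous.tendsto (by fun_prop) t

/-- The free evolution is jointly continuous. -/
theorem Filter.Tendsto.freeEvolution {ι : Type*} {l : Filter ι} {τ : ι → ℝ} {w : ι → OneParticle}
    {t : ℝ} {z : OneParticle} (hτ : Tendsto τ l (𝓝 t)) (hw : Tendsto w l (𝓝 z)) :
    Tendsto (fun i => freeEvolution m₀ (τ i) (w i)) l (𝓝 (freeEvolution m₀ t z)) := by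
  have h1 := (tendsto_freeEvolution (m₀ := m₀) t z).comp hτ
  have h2 : Tendsto (fun i => _root_.freeEvolution m₀ (τ i) (w i - z)) l (𝓝 0) := by
    rw [tendsto_zero_iff_norm_tendsto_zero]
    simp only [norm_freeEvolution]
    exact tendsto_iff_norm_sub_tendsto_zero.mp hw
  have h3 := h2.add h1
  rw [zero_add] at h3
  refine h3.congr fun i => ?_
  simp only [Function.comp, freeEvolution_sub, sub_add_cancel]

theorem Continuous.freeEvolution {X : Type*} [TopologicalSpace X] {τ : X → ℝ}
    {w : X → OneParticle} (hτ : Continuous τ) (hw : Continuous w) :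
    Continuous fun x => freeEvolution m₀ (τ x) (w x) :=
  continuous_iff_continuousAt.mpr fun x => Filter.Tendsto.freeEvolution (hτ.tendsto x) (hw.tendsto x)

/-- From |e^{iθ} - 1| ≤ |θ|. The growth in ω is what the smoothing by ω⁻¹ compensates. -/
theorem norm_phase_sub_le (hm : 0 < m₀) (s t k : ℝ) :
    ‖phase m₀ s k - phase m₀ t k‖ ≤ dispersion m₀ k * |s - t| := by
  have h : phase m₀ s k - phase m₀ t k =
      phase m₀ t k * (Complex.exp (Complex.I * ((-((s - t) * dispersion m₀ k) : ℝ) : ℂ)) - 1) := by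
    rw [mul_sub, mul_one, phase_apply, phase_apply, ← Complex.exp_add]
    congr 2
    push_cast
    ring
  rw [h, norm_mul, norm_phase_apply, one_mul]
  refine (Real.norm_exp_I_mul_ofReal_sub_one_le).trans ?_
  rw [Real.norm_eq_abs, abs_neg, abs_mul, abs_of_pos (dispersion_pos hm k), mul_comm]

/-- Smoothed by `ω^{-1}`, the orbits of the free evolution are differentiable. -/
theorem hasDerivAt_omegaInv_freeEvolution (hm : 0 < m₀) (t : ℝ) (z : OneParticle) :
    HasDerivAt (fun s => mulOp (omegaNegPow hm zero_le_one) (freeEvolution m₀ s z))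
      (-Complex.I • freeEvolution m₀ t z) t := by
  rw [hasDerivAt_iff_tendsto_slope]
  have hlim : -Complex.I • freeEvolution m₀ t z = mulOp (-Complex.I • phase m₀ t) z := by
    refine Lp.ext ?_
    filter_upwards [Lp.coeFn_smul (-Complex.I) (freeEvolution m₀ t z),
      coeFn_mulOp (phase m₀ t) z, coeFn_mulOp (-Complex.I • phase m₀ t) z] with k h1 h2 h3
    rw [h1, Pi.smul_apply, freeEvolution_eq_mulOp, h2, h3, BoundedContinuousFunction.smul_apply,
      smul_eq_mul, smul_eq_mul, mul_assoc]
  rw [hlim]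
  have hcongr : ∀ s, slope (fun s => mulOp (omegaNegPow hm zero_le_one) (freeEvolution m₀ s z)) t s
      = mulOp ((((s - t)⁻¹ : ℝ) : ℂ) • (omegaNegPow hm zero_le_one * (phase m₀ s - phase m₀ t))) z := by
    intro s
    rw [slope_def_module]
    refine Lp.ext ?_
    have e : (s - t)⁻¹ • (mulOp (omegaNegPow hm zero_le_one) (freeEvolution m₀ s z) -
        mulOp (omegaNegPow hm zero_le_one) (freeEvolution m₀ t z)) =
        (s - t)⁻¹ • mulOp (omegaNegPow hm zero_le_one)
          (mulOp (phase m₀ s) z - mulOp (phase m₀ t) z) := by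
      rw [map_sub]; rfl
    rw [e]
    filter_upwards [Lp.coeFn_smul (s - t)⁻¹ (mulOp (omegaNegPow hm zero_le_one)
        (mulOp (phase m₀ s) z - mulOp (phase m₀ t) z)),
      coeFn_mulOp (omegaNegPow hm zero_le_one) (mulOp (phase m₀ s) z - mulOp (phase m₀ t) z),
      Lp.coeFn_sub (mulOp (phase m₀ s) z) (mulOp (phase m₀ t) z),
      coeFn_mulOp (phase m₀ s) z, coeFn_mulOp (phase m₀ t) z,
      coeFn_mulOp ((((s - t)⁻¹ : ℝ) : ℂ) •
        (omegaNegPow hm zero_le_one * (phase m₀ s - phase m₀ t))) z] with k h1 h2 h3 h4 h5 h6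
    rw [h1, Pi.smul_apply, h2, h3, Pi.sub_apply, h4, h5, h6]
    simp only [BoundedContinuousFunction.smul_apply, BoundedContinuousFunction.mul_apply,
      BoundedContinuousFunction.sub_apply, smul_eq_mul, Complex.real_smul]
    ring
  refine Tendsto.congr (fun s => (hcongr s).symm) ?_
  -- The dominating constant is |s - t|⁻¹ · ω⁻¹ · ω|s - t| = 1, uniformly in k.
  refine tendsto_mulOp (C := 1) ?_ (fun k => ?_) z
  · filter_upwards [self_mem_nhdsWithin] with s hs k
    have hs' : 0 < |s - t| := abs_pos.mpr (sub_ne_zero.mpr hs)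
    have hd := dispersion_pos hm k
    simp only [BoundedContinuousFunction.smul_apply, BoundedContinuousFunction.mul_apply,
      BoundedContinuousFunction.sub_apply, smul_eq_mul, norm_mul, omegaNegPow_apply,
      Complex.norm_real, Real.norm_eq_abs, abs_inv, Real.rpow_neg_one, abs_of_pos hd]
    calc |s - t|⁻¹ * ((dispersion m₀ k)⁻¹ * ‖phase m₀ s k - phase m₀ t k‖)
        ≤ |s - t|⁻¹ * ((dispersion m₀ k)⁻¹ * (dispersion m₀ k * |s - t|)) := by
          gcongr
          exact norm_phase_sub_le hm s t k
      _ = 1 := by field_simp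
  · have hd : (dispersion m₀ k : ℂ) ≠ 0 := by exact_mod_cast (dispersion_pos hm k).ne'
    have h : HasDerivAt (fun s : ℝ => ((dispersion m₀ k : ℂ))⁻¹ * phase m₀ s k)
        (-Complex.I * phase m₀ t k) t := by
      have h0 : HasDerivAt (fun s : ℝ => -(Complex.I * (s : ℂ) * dispersion m₀ k))
          (-(Complex.I * 1 * dispersion m₀ k)) t :=
        (((Complex.ofRealCLM.hasDerivAt (x := t)).const_mul Complex.I).mul_const _).neg
      have h1 := (h0.cexp).const_mul ((dispersion m₀ k : ℂ))⁻¹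
      refine h1.congr_deriv ?_
      rw [phase_apply]
      field_simp
    have h2 := hasDerivAt_iff_tendsto_slope.mp h
    refine h2.congr fun s => ?_
    rw [slope_def_module]
    simp only [BoundedContinuousFunction.smul_apply, BoundedContinuousFunction.mul_apply,
      BoundedContinuousFunction.sub_apply, smul_eq_mul, Complex.real_smul, omegaNegPow_apply,
      Real.rpow_neg_one, Complex.ofReal_inv]
    ring

end Dispersion

/-! ### The field and its duality with the sources -/

section Field

open scoped BoundedContinuousFunction
open Filter Topology

variable {m₀ : ℝ}

/-- Here the dimension one enters: 1/(m₀² + k²) is integrable over ℝ, being a rescaling of 1/(1 +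
k²). -/
theorem memLp_omegaInv (hm : 0 < m₀) : MemLp (omegaNegPow hm zero_le_one) 2 := by
  rw [memLp_two_iff_integrable_sq_norm
    (omegaNegPow hm zero_le_one).continuous.aestronglyMeasurable]
  have h := (integrable_inv_one_add_sq.comp_div hm.ne').const_mul (m₀ ^ 2)⁻¹
  refine h.congr (Eventually.of_forall fun k => ?_)
  have hd := dispersion_pos hm k
  simp only [omegaNegPow_apply, Complex.norm_real, Real.norm_eq_abs, Real.rpow_neg_one,
    sq_abs, inv_pow, dispersion_sq]
  rw [← mul_inv]
  congr 1
  field_simp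

theorem memLp_omegaInv_mul_exp (hm : 0 < m₀) (x : ℝ) :
    MemLp (fun k : ℝ => omegaNegPow hm zero_le_one k * Complex.exp (-(Complex.I * k * x))) 2 :=
  (memLp_omegaInv hm).of_le
    ((omegaNegPow hm zero_le_one).continuous.mul (by fun_prop)).aestronglyMeasurable
    (Eventually.of_forall fun k => by simp [Complex.norm_exp])

/-- The vector `ω^{-1} e^{-ikx}` of `L²`. -/
noncomputable def fieldVector (hm : 0 < m₀) (x : ℝ) : OneParticle :=
  (memLp_omegaInv_mul_exp hm x).toLp _

theorem norm_fieldVector (hm : 0 < m₀) (x : ℝ) :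
    ‖fieldVector hm x‖ = ‖(memLp_omegaInv hm).toLp _‖ := by
  rw [fieldVector, Lp.norm_toLp, Lp.norm_toLp]
  congr 1
  exact eLpNorm_congr_norm_ae (Eventually.of_forall fun k => by simp [Complex.norm_exp])

theorem integrable_mulOp_omegaInv (hm : 0 < m₀) (y : OneParticle) :
    Integrable (mulOp (omegaNegPow hm zero_le_one) y) :=
  ((memLp_omegaInv hm).integrable_mul (Lp.memLp y)).congr (coeFn_mulOp _ y).symm

theorem inner_fieldVector (hm : 0 < m₀) (x : ℝ) (y : OneParticle) :
    inner ℂ (fieldVector hm x) y =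
      ∫ k : ℝ, mulOp (omegaNegPow hm zero_le_one) y k * Complex.exp (Complex.I * k * x) := by
  rw [L2.inner_def]
  refine integral_congr_ae ?_
  filter_upwards [(memLp_omegaInv_mul_exp hm x).coeFn_toLp,
    coeFn_mulOp (omegaNegPow hm zero_le_one) y] with k h1 h2
  rw [fieldVector, h1, h2, RCLike.inner_apply, map_mul, omegaNegPow_apply, Complex.conj_ofReal,
    ← Complex.exp_conj]
  simp only [map_neg, map_mul, Complex.conj_I, Complex.conj_ofReal, neg_mul, neg_neg]
  ring

theorem continuous_inner_fieldVector (hm : 0 < m₀) (y : OneParticle) :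
    Continuous fun x => inner ℂ (fieldVector hm x) y := by
  simp only [inner_fieldVector]
  refine continuous_of_dominated (bound := fun k => ‖mulOp (omegaNegPow hm zero_le_one) y k‖)
    (fun x => (Lp.aestronglyMeasurable _).mul (Continuous.aestronglyMeasurable (by fun_prop)))
    (fun x => Eventually.of_forall fun k => by simp [Complex.norm_exp])
    (integrable_mulOp_omegaInv hm y).norm (Eventually.of_forall fun k => by fun_prop)

theorem norm_two_mul_re_inner_fieldVector_le (hm : 0 < m₀) (y : OneParticle) (x : ℝ) :
    ‖2 * (inner ℂ (fieldVector hm x) y).re‖ ≤ 2 * ‖(memLp_omegaInv hm).toLp _‖ * ‖y‖ := by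
  rw [norm_mul, Real.norm_ofNat, mul_assoc, ← norm_fieldVector hm x]
  gcongr
  exact (Complex.abs_re_le_norm _).trans (norm_inner_le_norm _ _)

/-- The field `x ↦ 2 Re ∫ ω^{-1}(k) y(k) e^{ikx} dk`. -/
noncomputable def fieldMap (hm : 0 < m₀) : OneParticle →L[ℝ] (ℝ →ᵇ ℝ) :=
  LinearMap.mkContinuous
    { toFun := fun y => BoundedContinuousFunction.ofNormedAddCommGroup
        (fun x => 2 * (inner ℂ (fieldVector hm x) y).re)
        (continuous_const.mul (Complex.continuous_re.comp (continuous_inner_fieldVector hm y)))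
        (2 * ‖(memLp_omegaInv hm).toLp _‖ * ‖y‖) (norm_two_mul_re_inner_fieldVector_le hm y)
      map_add' := fun a b => by
        ext x
        change 2 * (inner ℂ (fieldVector hm x) (a + b)).re =
          2 * (inner ℂ (fieldVector hm x) a).re + 2 * (inner ℂ (fieldVector hm x) b).re
        rw [inner_add_right, Complex.add_re, mul_add]
      map_smul' := fun c a => by
        ext x
        change 2 * (inner ℂ (fieldVector hm x) (c • a)).re =
          c * (2 * (inner ℂ (fieldVector hm x) a).re)
        rw [inner_smul_right_eq_smul, Complex.smul_re, smul_eq_mul]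
        ring }
    (2 * ‖(memLp_omegaInv hm).toLp _‖)
    (fun y => BoundedContinuousFunction.norm_ofNormedAddCommGroup_le _ (by positivity)
      (norm_two_mul_re_inner_fieldVector_le hm y))

theorem fieldMap_apply (hm : 0 < m₀) (y : OneParticle) (x : ℝ) :
    fieldMap hm y x = 2 * (∫ k : ℝ, mulOp (omegaNegPow hm zero_le_one) y k *
      Complex.exp (Complex.I * k * x)).re := by
  rw [← inner_fieldVector]
  rfl

/-- The source map is dual to the field. -/
theorem integral_cutoff_mul_fieldMap {g : ℝ → ℝ} (hm : 0 < m₀) (hg1 : Integrable g)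
    (hg2 : MemLp g 2) (f : ℝ →ᵇ ℝ) (y : OneParticle) :
    ∫ x, g x * f x * fieldMap hm y x =
      2 * (inner ℂ (sourceMap hg1 hg2 f) (mulOp (omegaNegPow hm zero_le_one) y)).re := by
  set v := mulOp (omegaNegPow hm zero_le_one) y with hv
  have hvi : Integrable v := integrable_mulOp_omegaInv hm y
  -- Both g f and v = ω⁻¹ y are integrable, so the double integral converges absolutely and Fubini
  -- applies.
  have hprod : Integrable (fun p : ℝ × ℝ => (((g p.2 * f p.2 : ℝ) : ℂ) * v p.1) *
      Complex.exp (Complex.I * p.1 * p.2)) (volume.prod volume) := by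
    refine Integrable.mul_bdd (c := 1) ?_ (Continuous.aestronglyMeasurable (by fun_prop))
      (Eventually.of_forall fun p => by simp [Complex.norm_exp])
    exact (hvi.mul_prod (integrable_cutoff_mul hg1 f)).congr
      (Eventually.of_forall fun p => mul_comm _ _)
  have hinner : inner ℂ (sourceMap hg1 hg2 f) v =
      ∫ k : ℝ, ∫ x : ℝ, (((g x * f x : ℝ) : ℂ) * v k) * Complex.exp (Complex.I * k * x) := by
    rw [L2.inner_def]
    refine integral_congr_ae ?_
    filter_upwards [coeFn_sourceMap hg1 hg2 f] with k hk
    rw [hk, RCLike.inner_apply, angularFourier, ← integral_conj, ← integral_const_mul]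
    refine integral_congr_ae (Eventually.of_forall fun x => ?_)
    simp only [map_mul, Complex.conj_ofReal, ← Complex.exp_conj, map_neg, Complex.conj_I, neg_mul,
      neg_neg]
    ring
  have hswap : inner ℂ (sourceMap hg1 hg2 f) v =
      ∫ x : ℝ, ((g x * f x : ℝ) : ℂ) * ∫ k : ℝ, v k * Complex.exp (Complex.I * k * x) := by
    rw [hinner, integral_integral_swap hprod]
    refine integral_congr_ae (Eventually.of_forall fun x => ?_)
    simp only [mul_assoc, integral_const_mul]
  have hint : Integrable fun x : ℝ =>
      ((g x * f x : ℝ) : ℂ) * ∫ k : ℝ, v k * Complex.exp (Complex.I * k * x) := by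
    refine hprod.integral_prod_right.congr (Eventually.of_forall fun x => ?_)
    simp only [mul_assoc, integral_const_mul]
  rw [hswap, ← RCLike.re_eq_complex_re, ← integral_re hint, ← integral_const_mul]
  refine integral_congr_ae (Eventually.of_forall fun x => ?_)
  simp only [fieldMap_apply, RCLike.re_eq_complex_re, Complex.re_ofReal_mul]
  rw [← hv]
  ring

end Field

/-! ### Global solutions of bounded Lipschitz equations -/

section GlobalODE

open scoped NNReal
open Filter Topology Set

/-- Because the field is bounded by L, a ball of radius L(n + 1) contains the Picard iteration on
all of [-(n + 1), n + 1]. The resulting solutions agree where they overlap, by uniqueness, and glue.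
-/
theorem exists_forall_hasDerivAt_of_lipschitz_of_bounded {E : Type*} [NormedAddCommGroup E]
    [NormedSpace ℝ E] [CompleteSpace E] {f : ℝ → E → E} {K L : ℝ≥0}
    (hlip : ∀ t, LipschitzWith K (f t)) (hcont : ∀ x, Continuous fun t => f t x)
    (hbdd : ∀ t x, ‖f t x‖ ≤ L) (x₀ : E) :
    ∃ α : ℝ → E, α 0 = x₀ ∧ ∀ t, HasDerivAt α (f t (α t)) t := by
  have hloc : ∀ n : ℕ, ∃ α : ℝ → E, α 0 = x₀ ∧ ∀ t ∈ Icc (-((n : ℝ) + 1)) ((n : ℝ) + 1),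
      HasDerivWithinAt α (f t (α t)) (Icc (-((n : ℝ) + 1)) ((n : ℝ) + 1)) t := by
    intro n
    have h0 : (0 : ℝ) ∈ Icc (-((n : ℝ) + 1)) ((n : ℝ) + 1) := ⟨by linarith [n.cast_nonneg (α := ℝ)],
      by positivity⟩
    have hPL : IsPicardLindelof f (⟨0, h0⟩ : Icc (-((n : ℝ) + 1)) ((n : ℝ) + 1)) x₀
        (L * ((n : ℝ≥0) + 1)) 0 L K :=
      { lipschitzOnWith := fun t _ => (hlip t).lipschitzOnWith
        continuousOn := fun x _ => (hcont x).continuousOn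
        norm_le := fun t _ x _ => hbdd t x
        mul_max_le := by simp }
    exact hPL.exists_eq_forall_mem_Icc_hasDerivWithinAt₀
  choose α hα0 hα using hloc
  have hder : ∀ (n : ℕ), ∀ t ∈ Ioo (-((n : ℝ) + 1)) ((n : ℝ) + 1),
      HasDerivAt (α n) (f t (α n t)) t := fun n t ht =>
    (hα n t (Ioo_subset_Icc_self ht)).hasDerivAt (Icc_mem_nhds ht.1 ht.2)
  have hagree : ∀ (m n : ℕ), m ≤ n → EqOn (α m) (α n) (Icc (-((m : ℝ) + 1)) ((m : ℝ) + 1)) := by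
    intro m n hmn
    have hmn' : (m : ℝ) ≤ n := by exact_mod_cast hmn
    have hsub : Icc (-((m : ℝ) + 1)) ((m : ℝ) + 1) ⊆ Icc (-((n : ℝ) + 1)) ((n : ℝ) + 1) :=
      Icc_subset_Icc (by linarith) (by linarith)
    refine ODE_solution_unique_of_mem_Icc (v := f) (s := fun _ => univ) (K := K) (t₀ := 0)
      (fun t _ => (hlip t).lipschitzOnWith) ⟨by linarith [m.cast_nonneg (α := ℝ)], by positivity⟩
      (fun t ht => (hα m t ht).continuousWithinAt) (hder m) (fun _ _ => mem_univ _)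
      (fun t ht => (hα n t (hsub ht)).continuousWithinAt.mono hsub)
      (fun t ht => hder n t ⟨by linarith [ht.1], by linarith [ht.2]⟩) (fun _ _ => mem_univ _)
      ((hα0 m).trans (hα0 n).symm)
  have hglob : ∀ (n : ℕ), EqOn (fun s => α ⌈|s|⌉₊ s) (α n) (Ioo (-((n : ℝ) + 1)) ((n : ℝ) + 1)) := by
    intro n s hs
    have hc : |s| ≤ (⌈|s|⌉₊ : ℝ) := Nat.le_ceil _
    rcases le_total ⌈|s|⌉₊ n with h | h
    · exact hagree _ _ h (by
        rw [mem_Icc, ← abs_le]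
        linarith)
    · exact (hagree _ _ h (Ioo_subset_Icc_self hs)).symm
  -- Since |s| ≤ ⌈|s|⌉ < ⌈|s|⌉ + 1, the time s lies in the open interval of the chosen solution, so
  -- the glued function inherits a two-sided derivative.
  refine ⟨fun s => α ⌈|s|⌉₊ s, by simp [hα0], fun t => ?_⟩
  have ht : t ∈ Ioo (-((⌈|t|⌉₊ : ℝ) + 1)) ((⌈|t|⌉₊ : ℝ) + 1) := by
    rw [mem_Ioo, ← abs_lt]
    linarith [Nat.le_ceil |t|]
  exact (hder ⌈|t|⌉₊ t ht).congr_of_eventuallyEq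
    (eventually_of_mem (Ioo_mem_nhds ht.1 ht.2) (hglob ⌈|t|⌉₊))

end GlobalODE

/-! ### Secant slopes of a primitive -/

section Secant

open scoped NNReal BoundedContinuousFunction
open Filter Topology

variable {p : ℝ → ℝ} {K : ℝ≥0} {B : ℝ}

theorem norm_integral_unit_le (hB : ∀ s, |p s| ≤ B) (a b : ℝ) :
    ‖∫ θ in (0 : ℝ)..1, p (b + (a - b) * θ)‖ ≤ B := by
  have := intervalIntegral.norm_integral_le_of_norm_le_const (a := 0) (b := 1) (C := B)
    (f := fun θ => p (b + (a - b) * θ)) (fun θ _ => hB _)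
  simpa using this

/-- The secant slope `∫₀¹ p(v + θ(u - v)) dθ` of a primitive of `p`, along two bounded continuous
functions. -/
noncomputable def secant (hp : LipschitzWith K p) (hB : ∀ s, |p s| ≤ B) (u v : ℝ →ᵇ ℝ) :
    ℝ →ᵇ ℝ :=
  BoundedContinuousFunction.ofNormedAddCommGroup
    (fun x => ∫ θ in (0 : ℝ)..1, p (v x + (u x - v x) * θ))
    (intervalIntegral.continuous_parametric_intervalIntegral_of_continuous' (by
      have := hp.continuous
      have := u.continuous
      have := v.continuous
      fun_prop) 0 1) B (fun x => norm_integral_unit_le hB (u x) (v x))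

/-- Substitution in the integral. It writes an increment of the primitive as exactly linear in the
increment of the field, with no remainder term. -/
theorem secant_apply_mul (hp : LipschitzWith K p) (hB : ∀ s, |p s| ≤ B) (u v : ℝ →ᵇ ℝ) (x : ℝ) :
    secant hp hB u v x * (u x - v x) = (∫ s in (0 : ℝ)..u x, p s) - ∫ s in (0 : ℝ)..v x, p s := by
  have h := intervalIntegral.mul_integral_comp_add_mul (f := p) (a := 0) (b := 1) (u x - v x)
    (v x)
  rw [intervalIntegral.integral_interval_sub_left (hp.continuous.intervalIntegrable _ _)
    (hp.continuous.intervalIntegrable _ _), mul_comm]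
  rw [mul_zero, add_zero, mul_one, add_sub_cancel] at h
  exact h

/-- The points v + θ(u - v) stay within ‖u - v‖ of v, and p is K-Lipschitz. The estimate is uniform
in x, so it can be passed through `sourceMap`. -/
theorem norm_secant_sub_comp_le (hp : LipschitzWith K p) (hB : ∀ s, |p s| ≤ B) (u v : ℝ →ᵇ ℝ) :
    ‖secant hp hB u v - v.comp p hp‖ ≤ K * ‖u - v‖ := by
  refine (BoundedContinuousFunction.norm_le (by positivity)).mpr fun x => ?_
  have hc : Continuous fun θ : ℝ => p (v x + (u x - v x) * θ) :=
    hp.continuous.comp (by fun_prop)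
  have h : (secant hp hB u v - v.comp p hp) x =
      ∫ θ in (0 : ℝ)..1, (p (v x + (u x - v x) * θ) - p (v x)) := by
    rw [intervalIntegral.integral_sub (hc.intervalIntegrable _ _)
      (continuous_const.intervalIntegrable _ _)]
    simp [secant]
  rw [h]
  have h2 := intervalIntegral.norm_integral_le_of_norm_le_const (a := 0) (b := 1)
    (C := K * ‖u - v‖) (f := fun θ => p (v x + (u x - v x) * θ) - p (v x)) (fun θ hθ => by
      rw [Set.uIoc_of_le zero_le_one] at hθ
      refine (hp.norm_sub_le _ _).trans ?_
      gcongr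
      rw [add_sub_cancel_left, norm_mul, Real.norm_of_nonneg hθ.1.le]
      calc ‖u x - v x‖ * θ ≤ ‖u x - v x‖ * 1 := by gcongr; exact hθ.2
        _ ≤ ‖u - v‖ := by rw [mul_one]; exact (u - v).norm_coe_le_norm x)
  simpa using h2

theorem tendsto_secant {ι : Type*} {l : Filter ι} (hp : LipschitzWith K p) (hB : ∀ s, |p s| ≤ B)
    {u : ι → ℝ →ᵇ ℝ} {v : ℝ →ᵇ ℝ} (hu : Tendsto u l (𝓝 v)) :
    Tendsto (fun i => secant hp hB (u i) v) l (𝓝 (v.comp p hp)) := by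
  rw [tendsto_iff_norm_sub_tendsto_zero] at hu ⊢
  refine squeeze_zero (fun i => norm_nonneg _) (fun i => norm_secant_sub_comp_le hp hB (u i) v) ?_
  simpa using hu.const_mul (K : ℝ)

theorem lipschitzWith_primitive (hp : Continuous p) (hB : ∀ s, |p s| ≤ B) (c : ℝ) :
    LipschitzWith B.toNNReal fun s => c + ∫ r in (0 : ℝ)..s, p r := by
  refine LipschitzWith.of_dist_le' fun a b => ?_
  rw [dist_add_left, dist_eq_norm, intervalIntegral.integral_interval_sub_left
    (hp.intervalIntegrable _ _) (hp.intervalIntegrable _ _), Real.dist_eq]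
  exact intervalIntegral.norm_integral_le_of_norm_le_const fun r _ => hB r

end Secant

/-! ### The flow of a bounded Lipschitz nonlinearity and its energy -/

section Flow

open scoped NNReal BoundedContinuousFunction
open Filter Topology

variable {m₀ : ℝ} {g p : ℝ → ℝ} {K : ℝ≥0} {B : ℝ}

/-- The force `y ↦ ∫ g(x) p(Φ_y(x)) e^{-ikx} dx`, where `Φ_y` is the field. -/
noncomputable def force (hm : 0 < m₀) (hg1 : Integrable g) (hg2 : MemLp g 2)
    (hp : LipschitzWith K p) (y : OneParticle) : OneParticle :=
  sourceMap hg1 hg2 ((fieldMap hm y).comp p hp)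

theorem lipschitzWith_force (hm : 0 < m₀) (hg1 : Integrable g) (hg2 : MemLp g 2)
    (hp : LipschitzWith K p) :
    LipschitzWith (‖sourceMap hg1 hg2‖₊ * (K * ‖fieldMap hm‖₊)) (force hm hg1 hg2 hp) :=
  (sourceMap hg1 hg2).lipschitz.comp
    ((BoundedContinuousFunction.lipschitz_comp hp).comp (fieldMap hm).lipschitz)

theorem norm_force_le (hm : 0 < m₀) (hg1 : Integrable g) (hg2 : MemLp g 2)
    (hp : LipschitzWith K p) (hB : ∀ s, |p s| ≤ B) (y : OneParticle) :
    ‖force hm hg1 hg2 hp y‖ ≤ ‖sourceMap hg1 hg2‖ * B := by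
  refine (sourceMap hg1 hg2).le_opNorm_of_le ?_
  exact (BoundedContinuousFunction.norm_le ((abs_nonneg _).trans (hB 0))).mpr fun x => hB _

/-- The force in the interaction picture. -/
noncomputable def interactionField (hm : 0 < m₀) (hg1 : Integrable g) (hg2 : MemLp g 2)
    (hp : LipschitzWith K p) (t : ℝ) (w : OneParticle) : OneParticle :=
  -Complex.I • freeEvolution m₀ (-t) (force hm hg1 hg2 hp (freeEvolution m₀ t w))

theorem lipschitzWith_interactionField (hm : 0 < m₀) (hg1 : Integrable g) (hg2 : MemLp g 2)
    (hp : LipschitzWith K p) (t : ℝ) :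
    LipschitzWith (‖sourceMap hg1 hg2‖₊ * (K * ‖fieldMap hm‖₊))
      (interactionField hm hg1 hg2 hp t) := by
  refine LipschitzWith.of_dist_le_mul fun a b => ?_
  rw [dist_eq_norm, interactionField, interactionField, ← smul_sub, norm_smul, norm_neg,
    Complex.norm_I, one_mul, ← freeEvolution_sub, norm_freeEvolution]
  refine ((lipschitzWith_force hm hg1 hg2 hp).norm_sub_le _ _).trans (le_of_eq ?_)
  rw [← freeEvolution_sub, norm_freeEvolution, dist_eq_norm]

theorem continuous_interactionField (hm : 0 < m₀) (hg1 : Integrable g) (hg2 : MemLp g 2)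
    (hp : LipschitzWith K p) {w : ℝ → OneParticle} (hw : Continuous w) :
    Continuous fun t => interactionField hm hg1 hg2 hp t (w t) :=
  (Continuous.freeEvolution continuous_neg
    ((lipschitzWith_force hm hg1 hg2 hp).continuous.comp
      (Continuous.freeEvolution continuous_id hw))).const_smul (-Complex.I)

theorem norm_interactionField_le (hm : 0 < m₀) (hg1 : Integrable g) (hg2 : MemLp g 2)
    (hp : LipschitzWith K p) (hB : ∀ s, |p s| ≤ B) (t : ℝ) (w : OneParticle) :
    ‖interactionField hm hg1 hg2 hp t w‖ ≤ ‖sourceMap hg1 hg2‖ * B := by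
  rw [interactionField, norm_smul, norm_neg, Complex.norm_I, one_mul, norm_freeEvolution]
  exact norm_force_le hm hg1 hg2 hp hB _

/-- Conjugation by the isometries e^{itω} preserves both the Lipschitz constant and the bound of the
force. -/
theorem exists_interaction_flow (hm : 0 < m₀) (hg1 : Integrable g) (hg2 : MemLp g 2)
    (hp : LipschitzWith K p) (hB : ∀ s, |p s| ≤ B) (w₀ : OneParticle) :
    ∃ w : ℝ → OneParticle, w 0 = w₀ ∧
      ∀ t, HasDerivAt w (interactionField hm hg1 hg2 hp t (w t)) t :=
  exists_forall_hasDerivAt_of_lipschitz_of_bounded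
    (L := ⟨‖sourceMap hg1 hg2‖ * B, (norm_nonneg _).trans (norm_force_le hm hg1 hg2 hp hB 0)⟩)
    (lipschitzWith_interactionField hm hg1 hg2 hp)
    (fun _ => continuous_interactionField hm hg1 hg2 hp continuous_const)
    (norm_interactionField_le hm hg1 hg2 hp hB) w₀

/-- The potential energy `∫ g(x) (c + ∫₀^{Φ_y(x)} p) dx`. -/
noncomputable def potential (hm : 0 < m₀) (g p : ℝ → ℝ) (c : ℝ) (y : OneParticle) : ℝ :=
  ∫ x, g x * (c + ∫ s in (0 : ℝ)..fieldMap hm y x, p s)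

theorem integrable_mul_primitive (hm : 0 < m₀) (hg1 : Integrable g) (hp : LipschitzWith K p)
    (hB : ∀ s, |p s| ≤ B) (c : ℝ) (y : OneParticle) :
    Integrable fun x => g x * (c + ∫ s in (0 : ℝ)..fieldMap hm y x, p s) := by
  set f := (fieldMap hm y).comp _ (lipschitzWith_primitive hp.continuous hB c)
  exact hg1.mul_bdd f.continuous.aestronglyMeasurable
    (Eventually.of_forall fun x => f.norm_coe_le_norm x)

/-- The secant identity combined with the duality of source and field: the increment sees y only
through ω⁻¹ y. -/
theorem potential_sub (hm : 0 < m₀) (hg1 : Integrable g) (hg2 : MemLp g 2)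
    (hp : LipschitzWith K p) (hB : ∀ s, |p s| ≤ B) (c : ℝ) (y y' : OneParticle) :
    potential hm g p c y' - potential hm g p c y =
      2 * (inner ℂ (sourceMap hg1 hg2 (secant hp hB (fieldMap hm y') (fieldMap hm y)))
        (mulOp (omegaNegPow hm zero_le_one) y' - mulOp (omegaNegPow hm zero_le_one) y)).re := by
  rw [← map_sub, ← integral_cutoff_mul_fieldMap, potential, potential,
    ← integral_sub (integrable_mul_primitive hm hg1 hp hB c y')
      (integrable_mul_primitive hm hg1 hp hB c y)]
  refine integral_congr_ae (Eventually.of_forall fun x => ?_)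
  have h := secant_apply_mul hp hB (fieldMap hm y') (fieldMap hm y) x
  simp only [map_sub, BoundedContinuousFunction.sub_apply]
  rw [mul_assoc, h]
  ring

/-- In the formula for increments the secant converges by continuity of y alone, so
differentiability is needed only for ω⁻¹ y. -/
theorem hasDerivAt_potential (hm : 0 < m₀) (hg1 : Integrable g) (hg2 : MemLp g 2)
    (hp : LipschitzWith K p) (hB : ∀ s, |p s| ≤ B) (c : ℝ) {y : ℝ → OneParticle} {t : ℝ}
    {d : OneParticle} (hy : ContinuousAt y t)
    (hd : HasDerivAt (fun s => mulOp (omegaNegPow hm zero_le_one) (y s)) d t) :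
    HasDerivAt (fun s => potential hm g p c (y s))
      (2 * (inner ℂ (force hm hg1 hg2 hp (y t)) d).re) t := by
  rw [hasDerivAt_iff_tendsto_slope] at hd ⊢
  have h1 : Tendsto (fun s => fieldMap hm (y s)) (𝓝[≠] t) (𝓝 (fieldMap hm (y t))) :=
    ((fieldMap hm).continuous.continuousAt.comp hy).tendsto.mono_left nhdsWithin_le_nhds
  have h2 := ((sourceMap hg1 hg2).continuous.tendsto _).comp (tendsto_secant hp hB h1)
  have h3 := (Complex.continuous_re.tendsto _).comp (h2.inner (𝕜 := ℂ) hd)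
  refine (h3.const_mul 2).congr fun s => ?_
  rw [slope_def_field, potential_sub hm hg1 hg2 hp hB]
  simp only [Function.comp, slope_def_module]
  rw [inner_smul_right_eq_smul, Complex.smul_re, smul_eq_mul]
  ring

/-- A real multiplier is symmetric. This removes the term quadratic in the force from the energy
balance. -/
theorem im_inner_omegaInv_self (hm : 0 < m₀) (y : OneParticle) :
    (inner ℂ y (mulOp (omegaNegPow hm zero_le_one) y)).im = 0 := by
  have h : star (omegaNegPow hm zero_le_one) = omegaNegPow hm zero_le_one := by
    ext k
    rw [BoundedContinuousFunction.star_apply, omegaNegPow_apply, RCLike.star_def,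
      Complex.conj_ofReal]
  have h2 := inner_mulOp (omegaNegPow hm zero_le_one) y y
  rw [h, ← inner_conj_symm] at h2
  exact Complex.conj_eq_iff_im.mp h2

/-- The increment splits into (e^{-isω} - e^{-itω}) w(t), which needs the smoothing ω⁻¹, and
e^{-isω}(w(s) - w(t)), for which joint continuity of the free evolution suffices. -/
theorem hasDerivAt_omegaInv_orbit (hm : 0 < m₀) {w : ℝ → OneParticle} {w' : OneParticle} {t : ℝ}
    (hw : HasDerivAt w w' t) :
    HasDerivAt (fun s => mulOp (omegaNegPow hm zero_le_one) (freeEvolution m₀ s (w s)))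
      (-Complex.I • freeEvolution m₀ t (w t) +
        mulOp (omegaNegPow hm zero_le_one) (freeEvolution m₀ t w')) t := by
  have h1 := hasDerivAt_omegaInv_freeEvolution hm t (w t)
  rw [hasDerivAt_iff_tendsto_slope] at h1 hw ⊢
  have h2 := ((mulOp (omegaNegPow hm zero_le_one)).continuous.tendsto _).comp
    (Filter.Tendsto.freeEvolution (m₀ := m₀) (tendsto_id.mono_left nhdsWithin_le_nhds) hw)
  refine (h1.add h2).congr fun s => ?_
  simp only [Function.comp, slope_def_module, freeEvolution_eq_mulOp, id]
  rw [ContinuousLinearMap.map_smul_of_tower, ContinuousLinearMap.map_smul_of_tower, ← smul_add]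
  congr 1
  simp only [map_sub]
  abel

/-- Conservation of the energy `‖y‖² + ∫ g(x) (c + ∫₀^{Φ_y(x)} p) dx`. -/
theorem energy_conservation (hm : 0 < m₀) (hg1 : Integrable g) (hg2 : MemLp g 2)
    (hp : LipschitzWith K p) (hB : ∀ s, |p s| ≤ B) (c : ℝ) {w : ℝ → OneParticle}
    (hw : ∀ t, HasDerivAt w (interactionField hm hg1 hg2 hp t (w t)) t) (t : ℝ) :
    ‖w t‖ ^ 2 + potential hm g p c (freeEvolution m₀ t (w t)) =
      ‖w 0‖ ^ 2 + potential hm g p c (w 0) := by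
  have hwc : Continuous w := continuous_iff_continuousAt.mpr fun t => (hw t).continuousAt
  have hyc : Continuous fun t => freeEvolution m₀ t (w t) :=
    Continuous.freeEvolution continuous_id hwc
  have key : ∀ t, HasDerivAt
      (fun t => ‖w t‖ ^ 2 + potential hm g p c (freeEvolution m₀ t (w t))) 0 t := by
    intro t
    set y := freeEvolution m₀ t (w t) with hy
    set G := force hm hg1 hg2 hp y with hG
    have hV := hasDerivAt_potential hm hg1 hg2 hp hB c hyc.continuousAt
      (hasDerivAt_omegaInv_orbit hm (hw t))
    have hN : HasDerivAt (fun t => ‖w t‖ ^ 2)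
        (inner ℂ (w t) (interactionField hm hg1 hg2 hp t (w t)) +
          inner ℂ (interactionField hm hg1 hg2 hp t (w t)) (w t)).re t := by
      have h := Complex.reCLM.hasFDerivAt.comp_hasDerivAt t ((hw t).inner ℂ (hw t))
      refine h.congr_of_eventuallyEq (Eventually.of_forall fun s => ?_)
      exact (inner_self_eq_norm_sq (𝕜 := ℂ) (w s)).symm
    refine (hN.add hV).congr_deriv ?_
    -- The norm contributes 2 Im⟨y, G⟩ and the potential 2 Im⟨G, y⟩ + 2 Im⟨G, ω⁻¹ G⟩. The first two
    -- cancel and the last vanishes.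
    have e1 : (inner ℂ (interactionField hm hg1 hg2 hp t (w t)) (w t)).re =
        (inner ℂ (w t) (interactionField hm hg1 hg2 hp t (w t))).re :=
      inner_re_symm (𝕜 := ℂ) _ _
    have e2 : inner ℂ (w t) (interactionField hm hg1 hg2 hp t (w t)) = -Complex.I * inner ℂ y G := by
      rw [interactionField, inner_smul_right, ← inner_freeEvolution]
    have e3 : freeEvolution m₀ t (interactionField hm hg1 hg2 hp t (w t)) = -Complex.I • G := by
      rw [interactionField, freeEvolution_eq_mulOp, map_smul, ← freeEvolution_eq_mulOp,
        freeEvolution_self_neg]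
    have e4 := im_inner_omegaInv_self hm G
    have e5 : (inner ℂ G y).im = -(inner ℂ y G).im := inner_im_symm (𝕜 := ℂ) _ _
    rw [Complex.add_re, e1, e2, e3, map_smul, ← smul_add, inner_smul_right, inner_add_right]
    simp only [Complex.mul_re, Complex.neg_re, Complex.neg_im, Complex.I_re, Complex.I_im,
      Complex.add_im, Complex.add_re]
    rw [e4, e5]
    ring
  have h := is_const_of_deriv_eq_zero (fun t => (key t).differentiableAt)
    (fun t => (key t).deriv) t 0
  simpa only [freeEvolution_zero] using h

end Flow

/-! ### Truncation of the polynomial -/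

section Truncation

open scoped NNReal
open Filter Topology Set

/-- The derivative of a polynomial, frozen outside the interval `[-R, R]`. -/
noncomputable def clampedDeriv (P : Polynomial ℝ) (R s : ℝ) : ℝ :=
  P.derivative.eval (max (-R) (min R s))

theorem clamp_mem_Icc {R : ℝ} (hR : 0 ≤ R) (s : ℝ) : max (-R) (min R s) ∈ Icc (-R) R :=
  ⟨le_max_left _ _, max_le (by linarith) (min_le_left _ _)⟩

theorem clampedDeriv_of_mem {P : Polynomial ℝ} {R s : ℝ} (hs : |s| ≤ R) :
    clampedDeriv P R s = P.derivative.eval s := by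
  rw [abs_le] at hs
  rw [clampedDeriv, min_eq_right hs.2, max_eq_right hs.1]

theorem exists_lipschitzWith_clampedDeriv (P : Polynomial ℝ) {R : ℝ} (hR : 0 ≤ R) :
    ∃ K, LipschitzWith K (clampedDeriv P R) := by
  obtain ⟨C, hC⟩ := (isCompact_Icc (a := -R) (b := R)).exists_bound_of_continuousOn
    (f := fun s => P.derivative.derivative.eval s) (Polynomial.continuous _).continuousOn
  have hlip : LipschitzOnWith C.toNNReal (fun s => P.derivative.eval s) (Icc (-R) R) := by
    refine (convex_Icc _ _).lipschitzOnWith_of_nnnorm_hasDerivWithin_le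
      (fun s _ => (P.derivative.hasDerivAt s).hasDerivWithinAt) fun s hs => ?_
    rw [← NNReal.coe_le_coe, coe_nnnorm]
    exact (hC s hs).trans (Real.le_coe_toNNReal C)
  refine ⟨C.toNNReal, LipschitzWith.of_dist_le_mul fun a b => ?_⟩
  refine (hlip.dist_le_mul _ (clamp_mem_Icc hR a) _ (clamp_mem_Icc hR b)).trans ?_
  gcongr
  have h : LipschitzWith 1 fun s : ℝ => max (-R) (min R s) :=
    (LipschitzWith.id.const_min R).const_max (-R)
  simpa using h.dist_le_mul a b

theorem exists_abs_clampedDeriv_le (P : Polynomial ℝ) {R : ℝ} (hR : 0 ≤ R) :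
    ∃ B, ∀ s, |clampedDeriv P R s| ≤ B := by
  obtain ⟨C, hC⟩ := (isCompact_Icc (a := -R) (b := R)).exists_bound_of_continuousOn
    (f := fun s => P.derivative.eval s) (Polynomial.continuous _).continuousOn
  exact ⟨C, fun s => hC _ (clamp_mem_Icc hR s)⟩

/-- The segment from 0 to s stays in [-R, R], where the truncation is inactive. -/
theorem primitive_clampedDeriv_of_mem {P : Polynomial ℝ} {R s : ℝ} (hs : |s| ≤ R) :
    P.eval 0 + ∫ r in (0 : ℝ)..s, clampedDeriv P R r = P.eval s := by
  have h1 : ∫ r in (0 : ℝ)..s, clampedDeriv P R r = ∫ r in (0 : ℝ)..s, P.derivative.eval r := by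
    refine intervalIntegral.integral_congr fun r hr => clampedDeriv_of_mem ?_
    have h := abs_sub_left_of_mem_uIcc hr
    rw [sub_zero, sub_zero] at h
    exact h.trans hs
  rw [h1, intervalIntegral.integral_eq_sub_of_hasDerivAt (fun r _ => P.hasDerivAt r)
    ((Polynomial.continuous _).intervalIntegrable _ _)]
  ring

theorem eventually_derivative_eval_nonneg {P : Polynomial ℝ} (hlead : 0 < P.leadingCoeff) :
    ∀ᶠ s in atTop, 0 ≤ P.derivative.eval s := by
  rcases Nat.eq_zero_or_pos P.natDegree with h | h
  · rw [Polynomial.eq_C_of_natDegree_eq_zero h]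
    simp
  · have hl : 0 ≤ P.derivative.leadingCoeff := by
      rw [Polynomial.leadingCoeff_derivative]
      positivity
    rcases eq_or_ne P.derivative.natDegree 0 with h0 | h0
    · rw [Polynomial.eq_C_of_natDegree_eq_zero h0]
      refine Eventually.of_forall fun s => ?_
      rw [Polynomial.eval_C]
      rwa [Polynomial.leadingCoeff, h0] at hl
    · exact (Polynomial.tendsto_atTop_of_leadingCoeff_nonneg _
        (Polynomial.natDegree_pos_iff_degree_pos.mp (Nat.pos_of_ne_zero h0)) hl).eventually_ge_atTop 0

theorem leadingCoeff_comp_neg_X {P : Polynomial ℝ} (hdeg : Even P.natDegree) :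
    (P.comp (-Polynomial.X)).leadingCoeff = P.leadingCoeff := by
  rw [Polynomial.leadingCoeff_comp (by simp), Polynomial.leadingCoeff_neg,
    Polynomial.leadingCoeff_X, hdeg.neg_one_pow, mul_one]

/-- Reflection s ↦ -s: an even degree preserves the leading coefficient, while the chain rule flips
the sign of the derivative. -/
theorem eventually_derivative_eval_neg_nonpos {P : Polynomial ℝ} (hdeg : Even P.natDegree)
    (hlead : 0 < P.leadingCoeff) : ∀ᶠ s in atTop, P.derivative.eval (-s) ≤ 0 := by
  have h := eventually_derivative_eval_nonneg (P := P.comp (-Polynomial.X))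
    (by rwa [leadingCoeff_comp_neg_X hdeg])
  filter_upwards [h] with s hs
  simpa [Polynomial.derivative_comp] using hs

/-- The primitives of the truncated derivatives have a common lower bound. -/
theorem exists_lower_bound_primitive {P : Polynomial ℝ} (hdeg : Even P.natDegree)
    (hlead : 0 < P.leadingCoeff) :
    ∃ C, ∀ᶠ R in atTop, ∀ s, -C ≤ P.eval 0 + ∫ r in (0 : ℝ)..s, clampedDeriv P R r := by
  have h1 := eventually_derivative_eval_nonneg hlead
  have h2 := eventually_derivative_eval_neg_nonpos hdeg hlead
  obtain ⟨R₀, hR₀⟩ := eventually_atTop.mp (h1.and (h2.and (eventually_ge_atTop 0)))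
  obtain ⟨C, hC⟩ := (isCompact_Icc (a := -R₀) (b := R₀)).exists_bound_of_continuousOn
    (f := fun s => P.eval s) (Polynomial.continuous _).continuousOn
  have hR₀0 : 0 ≤ R₀ := (hR₀ R₀ le_rfl).2.2
  refine ⟨C, ?_⟩
  filter_upwards [eventually_ge_atTop R₀] with R hR s
  have hR0 : 0 ≤ R := hR₀0.trans hR
  obtain ⟨K, hK⟩ := exists_lipschitzWith_clampedDeriv P hR0
  have hc : ∀ a b, IntervalIntegrable (clampedDeriv P R) volume a b :=
    fun a b => hK.continuous.intervalIntegrable a b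
  have hbase : ∀ s ∈ Icc (-R₀) R₀,
      -C ≤ P.eval 0 + ∫ r in (0 : ℝ)..s, clampedDeriv P R r := fun s hs => by
    rw [primitive_clampedDeriv_of_mem ((abs_le.mpr hs).trans hR)]
    exact (abs_le.mp (hC s hs)).1
  -- The primitive equals P on [-R₀, R₀], decreases to the left of it and increases to the right.
  -- For R ≥ R₀, clamping a point beyond ±R₀ leaves it beyond ±R₀, so the sign of P' there survives.
  rcases lt_or_ge s (-R₀) with hs | hs
  · have e := intervalIntegral.integral_add_adjacent_intervals (hc 0 (-R₀)) (hc (-R₀) s)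
    have hneg : 0 ≤ ∫ r in s..(-R₀), -clampedDeriv P R r := by
      refine intervalIntegral.integral_nonneg hs.le fun r hr => ?_
      have := (hR₀ (-max (-R) (min R r)) (by
        rw [le_neg]
        exact max_le (by linarith) ((min_le_right _ _).trans hr.2))).2.1
      rw [neg_neg] at this
      exact neg_nonneg.mpr this
    rw [intervalIntegral.integral_neg, ← intervalIntegral.integral_symm] at hneg
    linarith [hbase (-R₀) ⟨le_rfl, by linarith⟩]
  · rcases lt_or_ge R₀ s with hs' | hs'
    · have e := intervalIntegral.integral_add_adjacent_intervals (hc 0 R₀) (hc R₀ s)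
      have hpos : 0 ≤ ∫ r in R₀..s, clampedDeriv P R r := by
        refine intervalIntegral.integral_nonneg hs'.le fun r hr => ?_
        exact (hR₀ _ ((le_min hR hr.1).trans (le_max_right _ _))).1
      linarith [hbase R₀ ⟨by linarith, le_rfl⟩]
    · exact hbase s ⟨hs, hs'⟩

end Truncation

/-! ### The derivative of the interaction in terms of the field -/

section Dbar

open scoped BoundedContinuousFunction
open Filter Topology

theorem continuous_integral_mul_exp {α : ℝ → ℂ} (hα : Integrable α) (ε : ℝ) :
    Continuous fun s : ℝ => ∫ k : ℝ, α k * Complex.exp (-(Complex.I * (ε * k) * s)) :=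
  continuous_of_dominated (bound := fun k => ‖α k‖)
    (fun s => hα.aestronglyMeasurable.mul (Continuous.aestronglyMeasurable (by fun_prop)))
    (fun s => Eventually.of_forall fun k => by simp [Complex.norm_exp]) hα.norm
    (Eventually.of_forall fun k => by fun_prop)

theorem norm_integral_mul_exp_le (α : ℝ → ℂ) (ε s : ℝ) :
    ‖∫ k : ℝ, α k * Complex.exp (-(Complex.I * (ε * k) * s))‖ ≤ ∫ k, ‖α k‖ := by
  refine (norm_integral_le_integral_norm _).trans (le_of_eq ?_)
  refine integral_congr_ae (Eventually.of_forall fun k => ?_)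
  simp [Complex.norm_exp]

theorem integrable_mul_pow_integral_mul_exp {α G : ℝ → ℂ} (hα : Integrable α) (hG : Integrable G)
    (ε : ℝ) (n : ℕ) :
    Integrable fun s : ℝ =>
      G s * (∫ k : ℝ, α k * Complex.exp (-(Complex.I * (ε * k) * s))) ^ n :=
  hG.mul_bdd (c := (∫ k, ‖α k‖) ^ n)
    ((continuous_integral_mul_exp hα ε).pow n).aestronglyMeasurable
    (Eventually.of_forall fun s => by
      rw [norm_pow]
      gcongr
      exact norm_integral_mul_exp_le α ε s)

/-- By Fubini, the exponential of the sum of momenta factorizes, and each momentum integral yields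
the same function of s. The sign ε selects α's transform or its reflection. -/
theorem integral_prod_mul_angularFourier {α G : ℝ → ℂ} (hα : Integrable α) (hG : Integrable G)
    (n : ℕ) (ε c : ℝ) :
    ∫ x : Fin n → ℝ, (∏ i, α (x i)) * angularFourier G (c + ε * ∑ i, x i) =
      angularFourier (fun s => G s *
        (∫ k : ℝ, α k * Complex.exp (-(Complex.I * (ε * k) * s))) ^ n) c := by
  have hprod : Integrable (fun q : (Fin n → ℝ) × ℝ => ((∏ i, α (q.1 i)) * G q.2) *
      Complex.exp (-(Complex.I * ((c + ε * ∑ i, q.1 i : ℝ) : ℂ) * q.2)))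
      (volume.prod volume) := by
    refine Integrable.mul_bdd (c := 1) ?_ (Continuous.aestronglyMeasurable (by fun_prop))
      (Eventually.of_forall fun q => ?_)
    · exact (Integrable.fintype_prod (fun _ : Fin n => hα)).mul_prod hG
    · rw [Complex.norm_exp]
      simp
  have h1 : ∀ x : Fin n → ℝ, (∏ i, α (x i)) * angularFourier G (c + ε * ∑ i, x i) =
      ∫ s : ℝ, ((∏ i, α (x i)) * G s) *
        Complex.exp (-(Complex.I * ((c + ε * ∑ i, x i : ℝ) : ℂ) * s)) := by
    intro x
    rw [angularFourier, ← integral_const_mul]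
    simp only [mul_assoc]
  simp only [h1]
  rw [integral_integral_swap hprod, angularFourier]
  refine integral_congr_ae (Eventually.of_forall fun s => ?_)
  have h2 : ∀ x : Fin n → ℝ, ((∏ i, α (x i)) * G s) *
      Complex.exp (-(Complex.I * ((c + ε * ∑ i, x i : ℝ) : ℂ) * s)) =
      (G s * Complex.exp (-(Complex.I * c * s))) *
        ∏ i, (α (x i) * Complex.exp (-(Complex.I * (ε * x i) * s))) := by
    intro x
    rw [Finset.prod_mul_distrib, ← Complex.exp_sum]
    have e : -(Complex.I * ((c + ε * ∑ i, x i : ℝ) : ℂ) * s) =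
        -(Complex.I * c * s) + ∑ i, -(Complex.I * (ε * x i) * s) := by
      rw [Finset.sum_neg_distrib, ← Finset.sum_mul, ← Finset.mul_sum, ← Finset.mul_sum]
      push_cast
      ring
    rw [e, Complex.exp_add]
    ring
  simp only [h2]
  rw [integral_const_mul]
  have h3 := integral_fintype_prod_volume_eq_pow (ι := Fin n)
    (fun k : ℝ => α k * Complex.exp (-(Complex.I * (ε * k) * s)))
  rw [Fintype.card_fin] at h3
  rw [h3]
  ring

variable {m₀ : ℝ} {g : ℝ → ℝ}

theorem formFactor_neg (k : ℝ) : formFactor m₀ (-k) = formFactor m₀ k := by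
  rw [formFactor, formFactor, dispersion_neg]

/-- Evenness of u absorbs the reflection of y in the form factors. The factors 1 and -1 are kept
explicit to match the parameter ε of `integral_prod_mul_angularFourier`. -/
theorem monomialKernel_snoc (q p : ℕ) (x : Fin q → ℝ) (k : ℝ) (y : Fin p → ℝ) :
    monomialKernel m₀ g (q + 1) p (Fin.snoc (α := fun _ => ℝ) x k) y =
      cutoffHat g ((k + 1 * ∑ i, x i) + (-1) * ∑ i, y i) *
        ((formFactor m₀ k : ℂ) * (∏ i, (formFactor m₀ (x i) : ℂ)) *
          ∏ i, (formFactor m₀ (y i) : ℂ)) := by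
  rw [monomialKernel, interactionKernel, Fin.sum_univ_add, Fin.prod_univ_add]
  simp only [Fin.append_left, Fin.append_right, Pi.neg_apply, formFactor_neg, Fin.sum_univ_castSucc,
    Fin.prod_univ_castSucc, Fin.snoc_castSucc, Fin.snoc_last, Finset.sum_neg_distrib]
  congr 2
  · ring
  · ring

theorem cutoffHat_eq_angularFourier (g : ℝ → ℝ) :
    cutoffHat g = angularFourier fun x => (g x : ℂ) := rfl

/-- The positive-frequency part `∫ u(k) z(k) e^{ikx} dk` of the field. -/
noncomputable def annihilationField (m₀ : ℝ) (z : ℝ → ℂ) (s : ℝ) : ℂ :=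
  ∫ k : ℝ, z k * formFactor m₀ k * Complex.exp (-(Complex.I * ((-1 : ℝ) * k) * s))

theorem conj_annihilationField (z : ℝ → ℂ) (s : ℝ) :
    conj (annihilationField m₀ z s) = ∫ k : ℝ, conj (z k) * formFactor m₀ k *
      Complex.exp (-(Complex.I * ((1 : ℝ) * k) * s)) := by
  rw [annihilationField, ← integral_conj]
  refine integral_congr_ae (Eventually.of_forall fun k => ?_)
  simp only [map_mul, Complex.conj_ofReal, ← Complex.exp_conj, map_neg, Complex.conj_I]
  push_cast
  ring_nf

/-- Two rounds of the Fubini lemma: the y-variables (ε = -1) produce powers of the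
positive-frequency field, then the x-variables (ε = 1) powers of its conjugate, with the result of
the first round as the new G. -/
theorem kernelDbar_monomialKernel {z : ℝ → ℂ} (hg1 : Integrable g)
    (hz : Integrable fun k => z k * (formFactor m₀ k : ℂ)) (q p : ℕ) (k : ℝ) :
    kernelDbar (monomialKernel m₀ g (q + 1) p) z k = ((q + 1 : ℕ) : ℂ) * formFactor m₀ k *
      angularFourier (fun s => (g s : ℂ) * annihilationField m₀ z s ^ p *
        conj (annihilationField m₀ z s) ^ q) k := by
  have hz' : Integrable fun k => conj (z k) * (formFactor m₀ k : ℂ) := by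
    refine ((Complex.conjCLE : ℂ →L[ℝ] ℂ).integrable_comp hz).congr
      (Eventually.of_forall fun k => ?_)
    simp
  have hgc : Integrable fun x => (g x : ℂ) := hg1.ofReal
  have hin : ∀ x : Fin q → ℝ, ∫ y : Fin p → ℝ,
      monomialKernel m₀ g (q + 1) p (Fin.snoc (α := fun _ => ℝ) x k) y * ∏ i, z (y i) =
      (formFactor m₀ k : ℂ) * (∏ i, (formFactor m₀ (x i) : ℂ)) *
        angularFourier (fun s => (g s : ℂ) * annihilationField m₀ z s ^ p) (k + 1 * ∑ i, x i) := by
    intro x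
    have h := integral_prod_mul_angularFourier hz hgc p (-1) (k + 1 * ∑ i, x i)
    rw [← cutoffHat_eq_angularFourier] at h
    unfold annihilationField
    rw [← h, ← integral_const_mul]
    refine integral_congr_ae (Eventually.of_forall fun y => ?_)
    simp only [monomialKernel_snoc, Finset.prod_mul_distrib]
    ring
  rw [kernelDbar]
  simp only [hin]
  have h := integral_prod_mul_angularFourier hz'
    (integrable_mul_pow_integral_mul_exp hz hgc (-1) p) q 1 k
  simp only [conj_annihilationField]
  unfold annihilationField
  rw [← h, mul_assoc]
  congr 1
  rw [← integral_const_mul]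
  refine integral_congr_ae (Eventually.of_forall fun x => ?_)
  simp only [map_prod, Finset.prod_mul_distrib]
  ring

theorem angularFourier_mul_const (G : ℝ → ℂ) (c : ℂ) (k : ℝ) :
    angularFourier (fun s => c * G s) k = c * angularFourier G k := by
  simp only [angularFourier, mul_assoc, integral_const_mul]

theorem angularFourier_sum {ι : Type*} (S : Finset ι) {G : ι → ℝ → ℂ}
    (hG : ∀ i ∈ S, Integrable (G i)) (k : ℝ) :
    angularFourier (fun s => ∑ i ∈ S, G i s) k = ∑ i ∈ S, angularFourier (G i) k := by
  simp only [angularFourier, Finset.sum_mul]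
  refine integral_finsetSum S fun i hi => ?_
  exact (hG i hi).mul_bdd (c := 1) (Continuous.aestronglyMeasurable (by fun_prop))
    (Eventually.of_forall fun x => by simp [Complex.norm_exp])

theorem integrable_annihilationField_pow {z : ℝ → ℂ} (hg1 : Integrable g)
    (hz : Integrable fun k => z k * (formFactor m₀ k : ℂ)) (p q : ℕ) :
    Integrable fun s => (g s : ℂ) * annihilationField m₀ z s ^ p *
      conj (annihilationField m₀ z s) ^ q := by
  have hgc : Integrable fun x => (g x : ℂ) := hg1.ofReal
  refine (integrable_mul_pow_integral_mul_exp hz hgc (-1) p).mul_bdd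
    (c := (∫ k, ‖z k * (formFactor m₀ k : ℂ)‖) ^ q) ?_ (Eventually.of_forall fun s => ?_)
  · exact ((Complex.continuous_conj.comp
      (continuous_integral_mul_exp hz (-1))).pow q).aestronglyMeasurable
  · rw [norm_pow, RCLike.norm_conj]
    gcongr
    exact norm_integral_mul_exp_le _ (-1) s

/-- The sum over `ℓ` of the derivatives of the monomials of degree `j`. -/
theorem sum_kernelDbar_monomialKernel (P : Polynomial ℝ) {z : ℝ → ℂ} (hg1 : Integrable g)
    (hz : Integrable fun k => z k * (formFactor m₀ k : ℂ)) (j : ℕ) (k : ℝ) :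
    ∑ l ∈ Finset.range (j + 1),
      (interactionCoeff P j l : ℂ) * kernelDbar (monomialKernel m₀ g l (j - l)) z k =
      angularFourier (fun s => (formFactor m₀ k : ℂ) * (((2 : ℝ) ^ (-(j : ℝ) / 2) : ℝ) : ℂ) *
        (P.coeff j : ℂ) * ((j : ℂ) * (g s : ℂ) *
          (conj (annihilationField m₀ z s) + annihilationField m₀ z s) ^ (j - 1))) k := by
  -- The ℓ = 0 term has no z̄ to differentiate. After the shift ℓ = l + 1, the identity (n+1)·C(n,
  -- l) = C(n+1, l+1)·(l+1) turns the remaining sum into a binomial expansion of exponent n = j - 1.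
  rw [Finset.sum_range_succ']
  have h0 : kernelDbar (monomialKernel m₀ g 0 (j - 0)) z k = 0 := rfl
  rw [h0, mul_zero, add_zero]
  rcases j with _ | n
  · simp [angularFourier]
  · have h1 : ∀ l ∈ Finset.range (n + 1), (interactionCoeff P (n + 1) (l + 1) : ℂ) *
        kernelDbar (monomialKernel m₀ g (l + 1) (n + 1 - (l + 1))) z k =
        angularFourier (fun s => ((formFactor m₀ k : ℂ) *
          (((2 : ℝ) ^ (-((n + 1 : ℕ) : ℝ) / 2) : ℝ) : ℂ) * (P.coeff (n + 1) : ℂ) *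
          ((n + 1 : ℕ) : ℂ) * (n.choose l : ℂ)) * ((g s : ℂ) * annihilationField m₀ z s ^ (n - l) *
            conj (annihilationField m₀ z s) ^ l)) k := by
      intro l _
      rw [kernelDbar_monomialKernel hg1 hz, angularFourier_mul_const, Nat.add_sub_add_right,
        interactionCoeff]
      have hc : ((n + 1 : ℕ) : ℂ) * (n.choose l : ℂ) =
          ((n + 1).choose (l + 1) : ℂ) * ((l + 1 : ℕ) : ℂ) := by
        exact_mod_cast Nat.add_one_mul_choose_eq n l
      rw [mul_assoc _ ((n + 1 : ℕ) : ℂ), hc, Complex.ofReal_mul, Complex.ofReal_mul,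
        Complex.ofReal_natCast]
      ring
    rw [Finset.sum_congr rfl h1, ← angularFourier_sum _ fun l _ =>
      (integrable_annihilationField_pow hg1 hz (n - l) l).const_mul _]
    congr 1
    funext s
    rw [Nat.add_sub_cancel, add_pow, Finset.mul_sum, Finset.mul_sum]
    refine Finset.sum_congr rfl fun l _ => ?_
    ring

/-- Summing the terms j β_j Φ^{j-1} over j rebuilds P'(Φ), once the powers of √2 are seen to cancel.
-/
theorem interactionDbar_eq_of_integrable (P : Polynomial ℝ) {z : ℝ → ℂ} {φ : ℝ → ℝ}
    (hg1 : Integrable g) (hz : Integrable fun k => z k * (formFactor m₀ k : ℂ))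
    (hφ : ∀ s, ((Real.sqrt 2 * φ s : ℝ) : ℂ) =
      conj (annihilationField m₀ z s) + annihilationField m₀ z s) (k : ℝ) :
    interactionDbar m₀ P g z k = ((dispersion m₀ k ^ (-(1 / 2) : ℝ) : ℝ) : ℂ) *
      angularFourier (fun s => ((g s * P.derivative.eval (φ s) : ℝ) : ℂ)) k := by
  have hint : ∀ j ∈ Finset.range (P.natDegree + 1), Integrable fun s =>
      (formFactor m₀ k : ℂ) * (((2 : ℝ) ^ (-(j : ℝ) / 2) : ℝ) : ℂ) *
        (P.coeff j : ℂ) * ((j : ℂ) * (g s : ℂ) *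
          (conj (annihilationField m₀ z s) + annihilationField m₀ z s) ^ (j - 1)) := by
    intro j _
    refine Integrable.const_mul ?_ _
    simp only [add_pow, Finset.mul_sum]
    refine integrable_finsetSum _ fun l _ => ?_
    refine ((integrable_annihilationField_pow hg1 hz (j - 1 - l) l).const_mul
      ((j : ℂ) * ((j - 1).choose l : ℂ))).congr (Eventually.of_forall fun s => ?_)
    ring
  rw [interactionDbar, Finset.sum_congr rfl fun j _ => sum_kernelDbar_monomialKernel P hg1 hz j k,
    ← angularFourier_sum _ hint, ← angularFourier_mul_const]
  congr 1
  funext s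
  simp only [← hφ]
  rw [Polynomial.derivative_eval, Polynomial.sum_over_range _ (by simp), formFactor]
  push_cast
  rw [Finset.mul_sum, Finset.mul_sum]
  refine Finset.sum_congr rfl fun j _ => ?_
  rcases j with _ | n
  · simp
  -- One √2 comes from u(k), the factor √2ⁿ from the n remaining fields, and 2^{-(n+1)/2} from the
  -- coefficient.
  · have h2 : Real.sqrt 2 * (2 : ℝ) ^ (-((n + 1 : ℕ) : ℝ) / 2) * Real.sqrt 2 ^ n = 1 := by
      rw [mul_right_comm, ← pow_succ', Real.sqrt_eq_rpow, ← Real.rpow_natCast,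
        ← Real.rpow_mul zero_le_two, ← Real.rpow_add zero_lt_two]
      rw [show (1 / 2 * ((n + 1 : ℕ) : ℝ) + -((n + 1 : ℕ) : ℝ) / 2) = 0 by ring, Real.rpow_zero]
    have h3 : (Real.sqrt 2 : ℂ) * (((2 : ℝ) ^ (-((n + 1 : ℕ) : ℝ) / 2) : ℝ) : ℂ) *
        (Real.sqrt 2 : ℂ) ^ n = 1 := by exact_mod_cast h2
    rw [Nat.add_sub_cancel, mul_pow]
    push_cast at h3 ⊢
    linear_combination (((dispersion m₀ k ^ (-(1 / 2) : ℝ) : ℝ) : ℂ) * (P.coeff (n + 1) : ℂ) *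
      ((n + 1 : ℂ) * (g s : ℂ) * (φ s : ℂ) ^ n)) * h3

theorem mul_formFactor_ae_eq (hm : 0 < m₀) (y : OneParticle) :
    (fun k => mulOp (omegaNegPow hm (by norm_num : (0 : ℝ) ≤ 1 / 2)) y k *
      (formFactor m₀ k : ℂ)) =ᵐ[volume]
      fun k => (Real.sqrt 2 : ℂ) * mulOp (omegaNegPow hm zero_le_one) y k := by
  filter_upwards [coeFn_mulOp (omegaNegPow hm (by norm_num : (0 : ℝ) ≤ 1 / 2)) y,
    coeFn_mulOp (omegaNegPow hm zero_le_one) y] with k h1 h2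
  have h : dispersion m₀ k ^ (-1 : ℝ) =
      dispersion m₀ k ^ (-(1 / 2) : ℝ) * dispersion m₀ k ^ (-(1 / 2) : ℝ) := by
    rw [← Real.rpow_add (dispersion_pos hm k)]
    norm_num
  rw [h1, h2, omegaNegPow_apply, omegaNegPow_apply, h, formFactor]
  push_cast
  ring

/-- At `z = ω^{-1/2} y`, the derivative of the interaction is `ω^{-1/2}` times the Fourier
transform of `g` times the derivative of `P` at the field. -/
theorem interactionDbar_eq (hm : 0 < m₀) (P : Polynomial ℝ) (hg1 : Integrable g)
    (y : OneParticle) (k : ℝ) :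
    interactionDbar m₀ P g (mulOp (omegaNegPow hm (by norm_num : (0 : ℝ) ≤ 1 / 2)) y) k =
      ((dispersion m₀ k ^ (-(1 / 2) : ℝ) : ℝ) : ℂ) *
        angularFourier (fun s => ((g s * P.derivative.eval (fieldMap hm y s) : ℝ) : ℂ)) k := by
  have hae := mul_formFactor_ae_eq hm y
  refine interactionDbar_eq_of_integrable P hg1
    (((integrable_mulOp_omegaInv hm y).const_mul _).congr hae.symm) (fun s => ?_) k
  have hA : annihilationField m₀ (mulOp (omegaNegPow hm (by norm_num : (0 : ℝ) ≤ 1 / 2)) y) s =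
      (Real.sqrt 2 : ℂ) * ∫ k : ℝ, mulOp (omegaNegPow hm zero_le_one) y k *
        Complex.exp (Complex.I * k * s) := by
    rw [annihilationField, ← integral_const_mul]
    refine integral_congr_ae ?_
    filter_upwards [hae] with k hk
    rw [hk]
    push_cast
    ring_nf
  rw [hA, fieldMap_apply, add_comm, Complex.add_conj, Complex.re_ofReal_mul]
  push_cast
  ring

end Dbar

/-! ### The energy space in the coordinate `y = ω^{1/2} z` -/

section EnergySpace

open Filter Topology

variable {m₀ : ℝ}

/-- The bounded operator `ω^{-1/2}` on `L²`. -/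
noncomputable def omegaInvSqrt (hm : 0 < m₀) : OneParticle →L[ℂ] OneParticle :=
  mulOp (omegaNegPow hm (by norm_num : (0 : ℝ) ≤ 1 / 2))

theorem coeFn_weighted {s : ℝ} (z : OmegaSpace m₀ s) :
    OmegaSpace.weighted z =ᵐ[volume]
      fun k => ((dispersion m₀ k ^ s : ℝ) : ℂ) * OmegaSpace.toL2 z k :=
  (memLp_of_mem_omegaDomain z.2).coeFn_toLp

theorem rpow_half_mul_rpow_neg_half (hm : 0 < m₀) (k : ℝ) :
    ((dispersion m₀ k ^ (1 / 2 : ℝ) : ℝ) : ℂ) * ((dispersion m₀ k ^ (-(1 / 2) : ℝ) : ℝ) : ℂ) =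
      1 := by
  rw [← Complex.ofReal_mul, ← Real.rpow_add (dispersion_pos hm k)]
  norm_num

theorem coeFn_omegaInvSqrt (hm : 0 < m₀) (y : OneParticle) :
    omegaInvSqrt hm y =ᵐ[volume]
      fun k => ((dispersion m₀ k ^ (-(1 / 2) : ℝ) : ℝ) : ℂ) * y k :=
  coeFn_mulOp _ y

theorem omegaInvSqrt_weighted (hm : 0 < m₀) (z : OmegaSpace m₀ (1 / 2)) :
    omegaInvSqrt hm (OmegaSpace.weighted z) = OmegaSpace.toL2 z := by
  refine Lp.ext ?_
  filter_upwards [coeFn_omegaInvSqrt hm (OmegaSpace.weighted z), coeFn_weighted z] with k h1 h2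
  rw [h1, h2, ← mul_assoc, mul_comm (_ : ℂ) ((dispersion m₀ k ^ (1 / 2 : ℝ) : ℝ) : ℂ),
    rpow_half_mul_rpow_neg_half hm, one_mul]

theorem rpow_half_mul_omegaInvSqrt (hm : 0 < m₀) (y : OneParticle) :
    (fun k => ((dispersion m₀ k ^ (1 / 2 : ℝ) : ℝ) : ℂ) * omegaInvSqrt hm y k) =ᵐ[volume] y := by
  filter_upwards [coeFn_omegaInvSqrt hm y] with k h1
  rw [h1, ← mul_assoc, rpow_half_mul_rpow_neg_half hm, one_mul]

theorem omegaInvSqrt_injective (hm : 0 < m₀) : Function.Injective (omegaInvSqrt hm) := by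
  intro a b hab
  refine Lp.ext ?_
  filter_upwards [rpow_half_mul_omegaInvSqrt hm a, rpow_half_mul_omegaInvSqrt hm b] with k h1 h2
  rw [← h1, ← h2, hab]

/-- The element `ω^{-1/2} y` of the energy space. -/
noncomputable def ofWeighted (hm : 0 < m₀) (y : OneParticle) : OmegaSpace m₀ (1 / 2) :=
  ⟨omegaInvSqrt hm y, (Lp.memLp y).ae_eq (rpow_half_mul_omegaInvSqrt hm y).symm⟩

theorem toL2_ofWeighted (hm : 0 < m₀) (y : OneParticle) :
    OmegaSpace.toL2 (ofWeighted hm y) = omegaInvSqrt hm y := rfl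

theorem weighted_ofWeighted (hm : 0 < m₀) (y : OneParticle) :
    OmegaSpace.weighted (ofWeighted hm y) = y :=
  omegaInvSqrt_injective hm (omegaInvSqrt_weighted hm (ofWeighted hm y))

theorem weighted_injective (hm : 0 < m₀) :
    Function.Injective (OmegaSpace.weighted (m₀ := m₀) (s := 1 / 2)) := by
  intro a b hab
  have h : OmegaSpace.toL2 a = OmegaSpace.toL2 b := by
    rw [← omegaInvSqrt_weighted hm a, ← omegaInvSqrt_weighted hm b, hab]
  exact Subtype.ext h

theorem continuous_weighted {s : ℝ} : Continuous (OmegaSpace.weighted (m₀ := m₀) (s := s)) := by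
  refine AddMonoidHomClass.continuous_of_bound _ 1 fun z => ?_
  rw [one_mul]
  exact abs_le_of_sq_le_sq' (by rw [OmegaSpace.norm_sq_eq]; nlinarith [sq_nonneg ‖OmegaSpace.toL2 z‖])
    (norm_nonneg _) |>.2

/-- The graph norm of ω^{-1/2}(b - a) is at most ‖b - a‖ + ‖ω^{-1/2}(b - a)‖, and m₀ > 0 makes
ω^{-1/2} bounded. -/
theorem continuous_ofWeighted (hm : 0 < m₀) : Continuous (ofWeighted hm) := by
  refine continuous_iff_continuousAt.mpr fun a => ?_
  rw [ContinuousAt, tendsto_iff_norm_sub_tendsto_zero]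
  have h : ∀ b, ‖ofWeighted hm b - ofWeighted hm a‖ ≤ ‖b - a‖ + ‖omegaInvSqrt hm (b - a)‖ := by
    intro b
    refine abs_le_of_sq_le_sq' ?_ (by positivity) |>.2
    rw [OmegaSpace.norm_sq_eq, map_sub, map_sub, weighted_ofWeighted, weighted_ofWeighted,
      toL2_ofWeighted, toL2_ofWeighted, ← map_sub]
    nlinarith [norm_nonneg (b - a), norm_nonneg (omegaInvSqrt hm (b - a)),
      mul_nonneg (norm_nonneg (b - a)) (norm_nonneg (omegaInvSqrt hm (b - a)))]
  refine squeeze_zero (fun b => norm_nonneg _) h ?_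
  have hc : Continuous fun b => ‖b - a‖ + ‖omegaInvSqrt hm (b - a)‖ := by fun_prop
  simpa using hc.tendsto a

theorem omegaInvSqrt_freeEvolution (hm : 0 < m₀) (t : ℝ) (y : OneParticle) :
    omegaInvSqrt hm (freeEvolution m₀ t y) = freeEvolution m₀ t (omegaInvSqrt hm y) := by
  rw [omegaInvSqrt, freeEvolution_eq_mulOp, mulOp_comm, freeEvolution_eq_mulOp]

end EnergySpace

/-! ### Mild solutions -/

section Mild

open scoped NNReal BoundedContinuousFunction
open Filter Topology

variable {m₀ : ℝ} {g : ℝ → ℝ} {K : ℝ≥0}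

theorem memLp_of_memH1 (hg1 : Integrable g) (hg : MemH1 g) : MemLp g 2 := by
  obtain ⟨f, hf, -⟩ := hg
  refine (Lp.memLp f).of_le hg1.aestronglyMeasurable ?_
  filter_upwards [hf] with x hx
  rw [hx, Complex.norm_real]

/-- While the field stays within [-R, R] the clamp is inactive, so the truncated force is the true
one. -/
theorem coeFn_omegaInvSqrt_force (hm : 0 < m₀) (hg1 : Integrable g) (hg2 : MemLp g 2)
    {P : Polynomial ℝ} {R : ℝ} (hp : LipschitzWith K (clampedDeriv P R)) {y : OneParticle}
    (hR : ‖fieldMap hm y‖ ≤ R) :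
    ∀ᵐ k, omegaInvSqrt hm (force hm hg1 hg2 hp y) k =
      interactionDbar m₀ P g (omegaInvSqrt hm y) k := by
  filter_upwards [coeFn_omegaInvSqrt hm (force hm hg1 hg2 hp y),
    coeFn_sourceMap hg1 hg2 ((fieldMap hm y).comp _ hp)] with k h1 h2
  rw [h1, force, h2, omegaInvSqrt, interactionDbar_eq hm P hg1]
  congr 3
  funext x
  rw [BoundedContinuousFunction.comp_apply,
    clampedDeriv_of_mem (((fieldMap hm y).norm_coe_le_norm x).trans hR)]

/-- Duhamel's formula, with the factor `ω^{-1/2}` and the free evolution pulled out. -/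
theorem duhamel_interactionField (hm : 0 < m₀) (hg1 : Integrable g) (hg2 : MemLp g 2)
    {p : ℝ → ℝ} (hp : LipschitzWith K p) {w : ℝ → OneParticle} (hw : Continuous w)
    (y₀ : OneParticle) (t : ℝ) :
    omegaInvSqrt hm (freeEvolution m₀ t
        (y₀ + ∫ τ in (0 : ℝ)..t, interactionField hm hg1 hg2 hp τ (w τ))) =
      freeEvolution m₀ t (omegaInvSqrt hm y₀) - Complex.I • ∫ τ in (0 : ℝ)..t,
        freeEvolution m₀ (t - τ)
          (omegaInvSqrt hm (force hm hg1 hg2 hp (freeEvolution m₀ τ (w τ)))) := by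
  have h := ContinuousLinearMap.intervalIntegral_comp_comm
    ((omegaInvSqrt hm).comp (mulOp (phase m₀ t)))
    ((continuous_interactionField hm hg1 hg2 hp hw).intervalIntegrable (μ := volume) 0 t)
  have h2 : omegaInvSqrt hm (freeEvolution m₀ t
        (y₀ + ∫ τ in (0 : ℝ)..t, interactionField hm hg1 hg2 hp τ (w τ))) =
      omegaInvSqrt hm (freeEvolution m₀ t y₀) + ((omegaInvSqrt hm).comp (mulOp (phase m₀ t)))
        (∫ τ in (0 : ℝ)..t, interactionField hm hg1 hg2 hp τ (w τ)) := by
    rw [freeEvolution_eq_mulOp, map_add, map_add]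
    rfl
  rw [h2, ← h, omegaInvSqrt_freeEvolution, sub_eq_add_neg, ← neg_smul,
    ← intervalIntegral.integral_smul]
  congr 1
  refine intervalIntegral.integral_congr fun τ _ => ?_
  simp only [interactionField, ContinuousLinearMap.comp_apply, map_smul]
  rw [← freeEvolution_eq_mulOp, ← freeEvolution_add, omegaInvSqrt_freeEvolution, sub_eq_add_neg]

theorem isMildSolution_of_hasDerivAt (hm : 0 < m₀) (hg1 : Integrable g) (hg2 : MemLp g 2)
    {P : Polynomial ℝ} {R : ℝ} (hp : LipschitzWith K (clampedDeriv P R)) {w : ℝ → OneParticle}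
    (hw : ∀ t, HasDerivAt w (interactionField hm hg1 hg2 hp t (w t)) t)
    (hR : ∀ t, ‖fieldMap hm (freeEvolution m₀ t (w t))‖ ≤ R) :
    IsMildSolution m₀ P g (omegaInvSqrt hm (w 0))
      (fun t => omegaInvSqrt hm (freeEvolution m₀ t (w t))) := by
  have hwc : Continuous w := continuous_iff_continuousAt.mpr fun t => (hw t).continuousAt
  have hFc : Continuous fun τ =>
      omegaInvSqrt hm (force hm hg1 hg2 hp (freeEvolution m₀ τ (w τ))) :=
    (omegaInvSqrt hm).continuous.comp ((lipschitzWith_force hm hg1 hg2 hp).continuous.comp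
      (Continuous.freeEvolution continuous_id hwc))
  refine ⟨fun τ => omegaInvSqrt hm (force hm hg1 hg2 hp (freeEvolution m₀ τ (w τ))),
    fun τ => coeFn_omegaInvSqrt_force hm hg1 hg2 hp (hR τ), fun t => ⟨?_, ?_⟩⟩
  · exact (Continuous.freeEvolution (continuous_const.sub continuous_id) hFc).intervalIntegrable _ _
  · rw [← duhamel_interactionField hm hg1 hg2 hp hwc,
      intervalIntegral.integral_eq_sub_of_hasDerivAt (fun τ _ => hw τ)
        ((continuous_interactionField hm hg1 hg2 hp hwc).intervalIntegrable _ _),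
      add_sub_cancel]

/-- In the interaction picture, a mild solution solves, as long as the field is bounded by `R`, the
integral equation with the truncated force. -/
theorem IsMildSolution.interaction_eq (hm : 0 < m₀) (hg1 : Integrable g) (hg2 : MemLp g 2)
    {P : Polynomial ℝ} {R T : ℝ} (hp : LipschitzWith K (clampedDeriv P R)) {y₀ : OneParticle}
    {y : ℝ → OneParticle} (hy : Continuous y)
    (h : IsMildSolution m₀ P g (omegaInvSqrt hm y₀) (fun t => omegaInvSqrt hm (y t)))
    (hR : ∀ t ∈ Set.Icc (-T) T, ‖fieldMap hm (y t)‖ ≤ R) {t : ℝ} (ht : t ∈ Set.Icc (-T) T) :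
    y₀ + ∫ τ in (0 : ℝ)..t, interactionField hm hg1 hg2 hp τ (freeEvolution m₀ (-τ) (y τ)) =
      freeEvolution m₀ (-t) (y t) := by
  obtain ⟨F, hF, hmild⟩ := h
  have hT : (0 : ℝ) ∈ Set.Icc (-T) T := ⟨by linarith [ht.1, ht.2], by linarith [ht.1, ht.2]⟩
  have hFeq : ∀ τ ∈ Set.uIcc 0 t, F τ = omegaInvSqrt hm (force hm hg1 hg2 hp (y τ)) := by
    intro τ hτ
    refine Lp.ext ?_
    filter_upwards [hF τ, coeFn_omegaInvSqrt_force hm hg1 hg2 hp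
      (hR τ (Set.uIcc_subset_Icc hT ht hτ))] with k h1 h2
    rw [h1, h2]
  have hwc : Continuous fun τ => freeEvolution m₀ (-τ) (y τ) :=
    Continuous.freeEvolution continuous_neg hy
  have hD := duhamel_interactionField hm hg1 hg2 hp hwc y₀ t
  have hI : ∫ τ in (0 : ℝ)..t, freeEvolution m₀ (t - τ) (F τ) =
      ∫ τ in (0 : ℝ)..t, freeEvolution m₀ (t - τ) (omegaInvSqrt hm
        (force hm hg1 hg2 hp (freeEvolution m₀ τ (freeEvolution m₀ (-τ) (y τ))))) := by
    refine intervalIntegral.integral_congr fun τ hτ => ?_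
    simp only [freeEvolution_self_neg, hFeq τ hτ]
  have hm2 := (hmild t).2
  simp only [hI] at hm2
  rw [← hD] at hm2
  rw [omegaInvSqrt_injective hm hm2, freeEvolution_neg_self]

/-- No energy argument is needed here: continuity in time already bounds both fields on a compact
interval, which fixes a truncation valid for both solutions. -/
theorem IsMildSolution.eq_of_continuous (hm : 0 < m₀) (hg1 : Integrable g) (hg2 : MemLp g 2)
    {P : Polynomial ℝ} {y₀ : OneParticle} {y₁ y₂ : ℝ → OneParticle} (hy₁ : Continuous y₁)
    (hy₂ : Continuous y₂)
    (h₁ : IsMildSolution m₀ P g (omegaInvSqrt hm y₀) (fun t => omegaInvSqrt hm (y₁ t)))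
    (h₂ : IsMildSolution m₀ P g (omegaInvSqrt hm y₀) (fun t => omegaInvSqrt hm (y₂ t))) :
    y₁ = y₂ := by
  funext t
  -- The added 1 keeps the initial time 0 interior to [-T, T], even when t = 0.
  set T : ℝ := |t| + 1 with hT
  have hbound : ∀ y : ℝ → OneParticle, Continuous y →
      ∃ C, ∀ s ∈ Set.Icc (-T) T, ‖fieldMap hm (y s)‖ ≤ C := fun y hy =>
    isCompact_Icc.exists_bound_of_continuousOn ((fieldMap hm).continuous.comp hy).continuousOn
  obtain ⟨C₁, hC₁⟩ := hbound y₁ hy₁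
  obtain ⟨C₂, hC₂⟩ := hbound y₂ hy₂
  set R := max 0 (max C₁ C₂) with hR
  obtain ⟨K, hp⟩ := exists_lipschitzWith_clampedDeriv P (le_max_left 0 (max C₁ C₂))
  -- The primitives `v y` are differentiable at every time, whereas they are known to equal e^{isω}
  -- y(s) only on [-T, T].
  set v : (ℝ → OneParticle) → ℝ → OneParticle := fun y s =>
    y₀ + ∫ τ in (0 : ℝ)..s, interactionField hm hg1 hg2 hp τ (freeEvolution m₀ (-τ) (y τ)) with hv
  have hvd : ∀ y : ℝ → OneParticle, Continuous y → ∀ s,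
      HasDerivAt (v y) (interactionField hm hg1 hg2 hp s (freeEvolution m₀ (-s) (y s))) s := by
    intro y hy s
    have hc := continuous_interactionField hm hg1 hg2 hp
      (Continuous.freeEvolution (m₀ := m₀) continuous_neg hy)
    exact (intervalIntegral.integral_hasDerivAt_right (hc.intervalIntegrable _ _)
      hc.aestronglyMeasurable.stronglyMeasurableAtFilter hc.continuousAt).const_add y₀
  have e₁ : ∀ s ∈ Set.Icc (-T) T, v y₁ s = freeEvolution m₀ (-s) (y₁ s) := fun s hs =>
    h₁.interaction_eq hm hg1 hg2 hp hy₁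
      (fun r hr => (hC₁ r hr).trans ((le_max_left _ _).trans (le_max_right _ _))) hs
  have e₂ : ∀ s ∈ Set.Icc (-T) T, v y₂ s = freeEvolution m₀ (-s) (y₂ s) := fun s hs =>
    h₂.interaction_eq hm hg1 hg2 hp hy₂
      (fun r hr => (hC₂ r hr).trans ((le_max_right _ _).trans (le_max_right _ _))) hs
  have hmem : t ∈ Set.Icc (-T) T := by
    rw [Set.mem_Icc, ← abs_le]
    linarith
  have hEq := ODE_solution_unique_of_mem_Icc (s := fun _ => Set.univ) (t₀ := 0) (a := -T) (b := T)
    (f := v y₁) (g := v y₂)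
    (fun s _ => (lipschitzWith_interactionField hm hg1 hg2 hp s).lipschitzOnWith)
    ⟨by linarith [abs_nonneg t], by linarith [abs_nonneg t]⟩
    (fun s _ => (hvd y₁ hy₁ s).continuousAt.continuousWithinAt)
    (fun s hs => by
      rw [e₁ s (Set.Ioo_subset_Icc_self hs)]
      exact hvd y₁ hy₁ s)
    (fun _ _ => Set.mem_univ _)
    (fun s _ => (hvd y₂ hy₂ s).continuousAt.continuousWithinAt)
    (fun s hs => by
      rw [e₂ s (Set.Ioo_subset_Icc_self hs)]
      exact hvd y₂ hy₂ s)
    (fun _ _ => Set.mem_univ _) (by simp [hv]) hmem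
  rw [e₁ t hmem, e₂ t hmem] at hEq
  rw [← freeEvolution_self_neg (m₀ := m₀) t (y₁ t), hEq, freeEvolution_self_neg]

/-- Conservation of energy bounds the field along the flow uniformly in the truncation. -/
theorem exists_flow_norm_fieldMap_le (hm : 0 < m₀) {P : Polynomial ℝ} (hdeg : Even P.natDegree)
    (hlead : 0 < P.leadingCoeff) (hg0 : ∀ᵐ x : ℝ, 0 ≤ g x) (hg1 : Integrable g)
    (hg2 : MemLp g 2) (y₀ : OneParticle) :
    ∃ (R : ℝ) (K : ℝ≥0) (hp : LipschitzWith K (clampedDeriv P R)) (w : ℝ → OneParticle),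
      w 0 = y₀ ∧ (∀ t, HasDerivAt w (interactionField hm hg1 hg2 hp t (w t)) t) ∧
        ∀ t, ‖fieldMap hm (freeEvolution m₀ t (w t))‖ ≤ R := by
  obtain ⟨C, hC⟩ := exists_lower_bound_primitive hdeg hlead
  -- E bounds the kinetic part at all times and does not involve R. Hence R can be chosen
  -- afterwards: large enough for the lower bound C, for the initial field, and for every field with
  -- ‖y‖² ≤ E.
  set E := ‖y₀‖ ^ 2 + (∫ x, g x * P.eval (fieldMap hm y₀ x)) + C * ∫ x, g x with hE
  obtain ⟨R, hlow, hR0, hRy, hRE⟩ := (hC.and ((eventually_ge_atTop 0).and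
    ((eventually_ge_atTop ‖fieldMap hm y₀‖).and
      (eventually_ge_atTop (‖fieldMap hm‖ * Real.sqrt E))))).exists
  obtain ⟨K, hp⟩ := exists_lipschitzWith_clampedDeriv P hR0
  obtain ⟨B, hB⟩ := exists_abs_clampedDeriv_le P hR0
  obtain ⟨w, hw0, hw⟩ := exists_interaction_flow hm hg1 hg2 hp hB y₀
  refine ⟨R, K, hp, w, hw0, hw, fun t => ?_⟩
  have hcons := energy_conservation hm hg1 hg2 hp hB (P.eval 0) hw t
  have hV0 : potential hm g (clampedDeriv P R) (P.eval 0) (w 0) =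
      ∫ x, g x * P.eval (fieldMap hm y₀ x) := by
    rw [hw0, potential]
    refine integral_congr_ae (Eventually.of_forall fun x => ?_)
    simp only [primitive_clampedDeriv_of_mem
      (((fieldMap hm y₀).norm_coe_le_norm x).trans hRy)]
  have hVt : -(C * ∫ x, g x) ≤
      potential hm g (clampedDeriv P R) (P.eval 0) (freeEvolution m₀ t (w t)) := by
    rw [← integral_const_mul, ← integral_neg, potential]
    refine integral_mono_ae (hg1.const_mul C).neg
      (integrable_mul_primitive hm hg1 hp hB (P.eval 0) _) ?_
    filter_upwards [hg0] with x hx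
    have := mul_le_mul_of_nonneg_left (hlow (fieldMap hm (freeEvolution m₀ t (w t)) x)) hx
    linarith
  have hsq : ‖w t‖ ^ 2 ≤ E := by
    rw [hV0, hw0] at hcons
    linarith
  have hwt : ‖w t‖ ≤ Real.sqrt E := Real.le_sqrt_of_sq_le hsq
  refine ((fieldMap hm).le_opNorm _).trans (le_trans ?_ hRE)
  rw [norm_freeEvolution]
  gcongr

end Mild

theorem mainTheorem4 (m₀ : ℝ) (hm₀ : 0 < m₀)
    (P : Polynomial ℝ) (hdeg : Even P.natDegree) (hlead : 0 < P.leadingCoeff)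
    (g : ℝ → ℝ) (hg_nonneg : ∀ᵐ x : ℝ, 0 ≤ g x) (hg_even : ∀ᵐ x : ℝ, g (-x) = g x)
    (hg_L1 : Integrable g) (hg_H1 : MemH1 g)
    (φ₀ : OmegaSpace m₀ (1 / 2)) :
    ∃! φ : C(ℝ, OmegaSpace m₀ (1 / 2)),
      IsMildSolution m₀ P g (OmegaSpace.toL2 φ₀) (fun t => OmegaSpace.toL2 (φ t)) := by
  have hg_L2 := memLp_of_memH1 hg_L1 hg_H1
  obtain ⟨R, K, hp, w, hw0, hw, hR⟩ := exists_flow_norm_fieldMap_le hm₀ hdeg hlead hg_nonneg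
    hg_L1 hg_L2 (OmegaSpace.weighted φ₀)
  have hwc : Continuous w := continuous_iff_continuousAt.mpr fun t => (hw t).continuousAt
  have hmild := isMildSolution_of_hasDerivAt hm₀ hg_L1 hg_L2 hp hw hR
  rw [hw0, omegaInvSqrt_weighted] at hmild
  refine ⟨⟨fun t => ofWeighted hm₀ (freeEvolution m₀ t (w t)), (continuous_ofWeighted hm₀).comp
    (Continuous.freeEvolution continuous_id hwc)⟩, hmild, fun ψ hψ => ?_⟩
  -- Writing each curve as ω^{-1/2} of its weighted version puts both solutions in the coordinate y,
  -- where uniqueness is available.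
  simp only [← omegaInvSqrt_weighted hm₀] at hmild hψ
  have h := IsMildSolution.eq_of_continuous hm₀ hg_L1 hg_L2
    (continuous_weighted.comp ψ.continuous) (Continuous.freeEvolution continuous_id hwc) hψ hmild
  exact ContinuousMap.ext fun t => weighted_injective hm₀
    ((congrFun h t).trans (weighted_ofWeighted hm₀ _).symm)
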